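/- **Jacobi's field equation.** Let $M\subset\mathbb R^N$ be an oriented $m$-dimensional smooth (embedded) submanifold. Write $AB$ for the geometric (Clifford) product on the geometric algebra $\bigwedge_*\mathbb R^N$ (so $vv=\langle v,v\rangle$ for vectors $v$), $\wedge$ for the exterior product and $\langle\cdot\rangle_r$ for the grade-$r$ part. Let $\mathfrak T(x)=\tau_1\wedge\dots\wedge\tau_m$, for $\tau_1,\dots,\tau_m$ a positively oriented orthonormal frame of $T_xM$, be the Gauss map of $M$. Let $(a\cdot\partial)$ be the directional derivative along a tangent vector $a$. For a multivector field $F$ on $M$ put $\partial\wedge F=\sum_j\tau_j\wedge(\tau_j\cdot\partial)F$, let $\Delta_M$ be the Laplace–Beltrami operator of $M$, acting coordinate-wise on vector- or multivector-valued functions, and for scalar functions $\varphi$ and vector fields $X$ on $M$ put $\partial\varphi=\sum_j\big((\tau_j\cdot\partial)\varphi\big)\,\tau_j$ and $\partial\cdot X=\sum_j\langle\tau_j,(\tau_j\cdot\partial)X\rangle$. Let $P_x$ be the orthogonal projection of $\mathbb R^N$ onto $T_xM$. For $a\in T_xM$ let $S(a)=\sum_l\tau_l\,\big((\tau_l\cdot\partial)P\big)(a)$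 (geometric product) and $S_a=\sum_l\tau_l\wedge\big((\tau_l\cdot\partial)P\big)(a)$ be the shape and the shape bivector, and let $S(\partial_a)\wedge S_a=\sum_j S(\tau_j)\wedge S_{\tau_j}$. Let $B(a,b)=\big((a\cdot\partial)b\big)^\perp$ be the second fundamental form, $|B|^2=\sum_{j,l}|B(\tau_j,\tau_l)|^2$, and let $H=\sum_jB(\tau_j,\tau_j)$ be the mean curvature vector. Then on $M$ $$\Delta_M\mathfrak T+|B|^2\,\mathfrak T-\big\langle\big(S(\partial_a)\wedge S_a\big)\mathfrak T\big\rangle_m+(\partial\wedge H)\,\mathfrak T\equiv 0 .$$ If $N=m+1$ and $n$ is a continuous unit normal vector field on $M$, with mean curvature $\mathcal H=-\partial\cdot n$, then on $M$ $$S(\partial_a)\wedge S_a\equiv 0,\qquad (\partial\wedge H)\,n=\partial\mathcal H,$$ and the classical Jacobi field equation holds: $$\Delta_M n+|B|^2\,n+\partial\mathcal H=0 .$$ -/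

import Mathlib

open scoped ContDiff

noncomputable section

namespace GeomCalc

/-- The Euclidean vector space `ℝ^N`. -/
abbrev Euc (N : ℕ) : Type := EuclideanSpace ℝ (Fin N)

/-! ### Geometric algebra -/

/-- The quadratic form `v ↦ ⟪v, v⟫` on `ℝ^N`. -/
abbrev sqForm (N : ℕ) : QuadraticForm ℝ (Euc N) :=
  LinearMap.BilinMap.toQuadraticMap (innerₗ (Euc N))

/-- The geometric (Clifford) algebra of `ℝ^N`; juxtaposition `*` is the geometric product, and
`v * v = ⟪v, v⟫` for vectors `v`. -/
abbrev GA (N : ℕ) : Type := CliffordAlgebra (sqForm N)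

/-- The inclusion of vectors into the geometric algebra. -/
abbrev vec {N : ℕ} (v : Euc N) : GA N := CliffordAlgebra.ι (sqForm N) v

/-- The canonical linear identification of the geometric algebra with the exterior algebra. -/
abbrev toExt (N : ℕ) : GA N ≃ₗ[ℝ] ExteriorAlgebra ℝ (Euc N) :=
  CliffordAlgebra.equivExterior (sqForm N)

/-- Coordinates of a multivector with respect to the blades `e_{i₁} ∧ … ∧ e_{iᵣ}`, `i₁ < … < iᵣ`,
of the standard basis of `ℝ^N`. -/
def coords (N : ℕ) : GA N ≃ₗ[ℝ] EuclideanSpace ℝ (Finset (Fin N)) :=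
  ((toExt N).trans (EuclideanSpace.basisFun (Fin N) ℝ).toBasis.ExteriorAlgebra.equivFun).trans
    (WithLp.linearEquiv 2 ℝ (Finset (Fin N) → ℝ)).symm

/-- The norm of multivectors, `|A|² = A * Aᵗ`, for which the standard blades are orthonormal. -/
instance (N : ℕ) : NormedAddCommGroup (GA N) :=
  NormedAddCommGroup.induced (GA N) (EuclideanSpace ℝ (Finset (Fin N))) (coords N)
    (coords N).injective

instance (N : ℕ) : NormedSpace ℝ (GA N) :=
  NormedSpace.induced ℝ (GA N) (EuclideanSpace ℝ (Finset (Fin N))) (coords N)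

/-- The exterior product of multivectors. -/
def wedge {N : ℕ} (A B : GA N) : GA N := (toExt N).symm (toExt N A * toExt N B)

/-- The part `⟨A⟩_r` of grade `r` of a multivector. -/
def gradePart {N : ℕ} (r : ℕ) (A : GA N) : GA N :=
  (toExt N).symm (GradedAlgebra.proj (fun i : ℕ => ⋀[ℝ]^i (Euc N)) r (toExt N A))

/-- The `m`-blade `a₁ ∧ … ∧ a_m`. -/
def blade {N m : ℕ} (a : Fin m → Euc N) : GA N :=
  (toExt N).symm (ExteriorAlgebra.ιMulti ℝ m a)

/-! ### Submanifolds, tangent spaces, Gauss map -/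

/-- `M` is an (embedded, boundaryless) smooth submanifold of dimension `m` of `ℝ^N`: near each of
its points some smooth diffeomorphism between open sets of `ℝ^N` maps `M` onto an `m`-dimensional
linear subspace. -/
def IsSmoothSubmanifold {N : ℕ} (m : ℕ) (M : Set (Euc N)) : Prop :=
  ∀ x ∈ M, ∃ (Φ : OpenPartialHomeomorph (Euc N) (Euc N)) (W : Submodule ℝ (Euc N)),
    x ∈ Φ.source ∧ ContDiffOn ℝ ∞ Φ Φ.source ∧ ContDiffOn ℝ ∞ Φ.symm Φ.target ∧
      Module.finrank ℝ W = m ∧ ∀ y ∈ Φ.source, y ∈ M ↔ Φ y ∈ W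

/-- The tangent space `T_x M`, as a linear subspace of `ℝ^N`. -/
def tangentSpace {N : ℕ} (M : Set (Euc N)) (x : Euc N) : Submodule ℝ (Euc N) :=
  Submodule.span ℝ (tangentConeAt ℝ M x)

/-- The orthogonal projection `P` of `ℝ^N` onto `T_x M`. -/
def proj {N : ℕ} (M : Set (Euc N)) (x : Euc N) : Euc N →L[ℝ] Euc N :=
  (tangentSpace M x).starProjection

/-- An orthonormal frame `τ_j` of `T_x M`. -/
def frame {N : ℕ} (M : Set (Euc N)) (x : Euc N) :
    OrthonormalBasis (Fin (Module.finrank ℝ (tangentSpace M x))) ℝ (tangentSpace M x) :=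
  stdOrthonormalBasis ℝ (tangentSpace M x)

/-- The sum `∑ j, f τ_j` over an orthonormal frame `τ_j` of `T_x M`. -/
def frameSum {N : ℕ} {V : Type*} [AddCommMonoid V] (M : Set (Euc N)) (x : Euc N)
    (f : Euc N → V) : V :=
  ∑ j, f (frame M x j : Euc N)

/-- `T` is the Gauss map of `M` for some orientation of `M`: a continuous field of unit `m`-blades
`T x = τ₁ ∧ … ∧ τ_m` with `τ₁, …, τ_m` an orthonormal frame of `T_x M`. (The orientation of `M` is
the one for which all these frames are positively oriented.) -/
def IsGaussMap {N : ℕ} (m : ℕ) (M : Set (Euc N)) (T : Euc N → GA N) : Prop :=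
  ContinuousOn T M ∧
    ∀ x ∈ M, ∃ τ : OrthonormalBasis (Fin m) ℝ (tangentSpace M x),
      T x = blade fun j => (τ j : Euc N)

/-! ### Derivatives on a submanifold -/

section Derivatives

variable {N : ℕ} {V : Type*} [NormedAddCommGroup V] [NormedSpace ℝ V]

/-- The directional derivative `(a·∂)F` at `x ∈ M` of a function `F` on `M`, in the direction of a
tangent vector `a ∈ T_x M`. Only the values of `F` on `M` matter. -/
def dirDeriv (M : Set (Euc N)) (F : Euc N → V) (x a : Euc N) : V :=
  fderivWithin ℝ F M x a

/-- The directional derivative is the derivative along any curve in `M` with velocity `a`. -/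
theorem dirDeriv_eq_along_curve {M : Set (Euc N)} {F : Euc N → V} {x a : Euc N}
    (hF : DifferentiableWithinAt ℝ F M x) {γ : ℝ → Euc N} (hγM : ∀ t, γ t ∈ M) (h0 : γ 0 = x)
    (hγ : HasDerivAt γ a 0) : HasDerivAt (fun t => F (γ t)) (dirDeriv M F x a) 0 := by
  have h := hF.hasFDerivWithinAt
  rw [← h0] at h
  have h2 := h.comp_hasDerivWithinAt (s := Set.univ) (0 : ℝ) hγ.hasDerivWithinAt
    (fun t _ => hγM t)
  rw [hasDerivWithinAt_univ, h0] at h2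
  exact h2

/-- Derivatives in tangent directions do not depend on the choice made by `fderivWithin`. -/
theorem dirDeriv_eq {M : Set (Euc N)} {F : Euc N → V} {x a : Euc N} {F' : Euc N →L[ℝ] V}
    (hF : HasFDerivWithinAt F F' M x) (ha : a ∈ tangentSpace M x) :
    dirDeriv M F x a = F' a := by
  have h : Set.EqOn (fderivWithin ℝ F M x).toLinearMap F'.toLinearMap (tangentConeAt ℝ M x) :=
    hF.differentiableWithinAt.hasFDerivWithinAt.unique_on hF
  exact LinearMap.eqOn_span h ha

/-- The Laplace–Beltrami operator of `M`: the trace over `T_x M` of the covariant derivative of the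
differential `y ↦ (b ↦ (P_y b·∂)F(y))`. For `F` with values in a vector space it acts
coordinate-wise. Equivalently `∑ j, (τ_j·∂)(τ_j·∂)F` for the extension `y ↦ P_y τ_j` of an
orthonormal frame at `x`, whose covariant derivative vanishes at `x`. -/
def laplaceBeltrami (M : Set (Euc N)) (F : Euc N → V) (x : Euc N) : V :=
  frameSum M x fun τ => dirDeriv M (fun y => dirDeriv M F y (proj M y τ)) x τ

/-- The gradient `∂φ` of a scalar function on `M`; it is a tangent vector field. -/
def gradient (M : Set (Euc N)) (φ : Euc N → ℝ) (x : Euc N) : Euc N :=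
  frameSum M x fun τ => dirDeriv M φ x τ • τ

/-- The divergence `∂·X` along `M` of a vector field `X` on `M`. -/
def divergence (M : Set (Euc N)) (X : Euc N → Euc N) (x : Euc N) : ℝ :=
  frameSum M x fun τ => inner ℝ τ (dirDeriv M X x τ)

/-- The curl `∂ ∧ F` of a multivector field `F` on `M`. -/
def curl (M : Set (Euc N)) (F : Euc N → GA N) (x : Euc N) : GA N :=
  frameSum M x fun τ => wedge (vec τ) (dirDeriv M F x τ)

/-- On scalar functions the Laplace–Beltrami operator is the divergence of the gradient. -/
theorem laplaceBeltrami_eq_divergence_gradient {M : Set (Euc N)} {φ : Euc N → ℝ} {x : Euc N}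
    (h : DifferentiableWithinAt ℝ (gradient M φ) M x) :
    laplaceBeltrami M φ x = divergence M (gradient M φ) x := by
  have key : ∀ b y : Euc N, dirDeriv M φ y (proj M y b) = inner ℝ b (gradient M φ y) := by
    intro b y
    have hp : proj M y b = ∑ j, inner ℝ (frame M y j : Euc N) b • (frame M y j : Euc N) := by
      have h1 := (frame M y).sum_repr ((tangentSpace M y).orthogonalProjectionOnto b)
      have h2 := congrArg (Submodule.subtype _) h1
      rw [map_sum] at h2
      simp only [map_smul, Submodule.subtype_apply, OrthonormalBasis.repr_apply_apply] at h2
      rw [proj, Submodule.starProjection_apply, ← h2]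
      refine Finset.sum_congr rfl fun j _ => ?_
      rw [Submodule.inner_orthogonalProjectionOnto_eq_of_mem_left]
    simp only [gradient, frameSum, dirDeriv, hp, map_sum, map_smul, inner_sum, inner_smul_right,
      smul_eq_mul]
    refine Finset.sum_congr rfl fun j _ => ?_
    rw [real_inner_comm, mul_comm]
  unfold laplaceBeltrami divergence frameSum
  refine Finset.sum_congr rfl fun j _ => ?_
  simp only [key]
  have h1 := (innerSL ℝ (frame M x j : Euc N)).hasFDerivAt.comp_hasFDerivWithinAt x
    h.hasFDerivWithinAt
  exact dirDeriv_eq h1 (frame M x j).2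

end Derivatives

/-! ### Shape operator, second fundamental form, mean curvature -/

section Shape

variable {N : ℕ}

/-- The derivative `((b·∂)P)(a)` of the field of tangential projections. -/
def projDeriv (M : Set (Euc N)) (x b a : Euc N) : Euc N := dirDeriv M (proj M) x b a

/-- The shape `S(a) = ∂̇ Ṗ(a)` of a vector `a` (geometric product). -/
def shape (M : Set (Euc N)) (x a : Euc N) : GA N :=
  frameSum M x fun τ => vec τ * vec (projDeriv M x τ a)

/-- The shape bivector `S_a = ∂̇ ∧ Ṗ(a)`. -/
def shapeBivector (M : Set (Euc N)) (x a : Euc N) : GA N :=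
  frameSum M x fun τ => wedge (vec τ) (vec (projDeriv M x τ a))

/-- The `4`-vector `S(∂_a) ∧ S_a = ∑ j, S(τ_j) ∧ S_{τ_j}`. -/
def shapeWedgeShape (M : Set (Euc N)) (x : Euc N) : GA N :=
  frameSum M x fun τ => wedge (shape M x τ) (shapeBivector M x τ)

/-- The second fundamental form `B(a, b) = ((a·∂)b)^⊥` of `M` at `x`, for `a, b ∈ T_x M`, where `b`
is extended to the tangent vector field `y ↦ P_y b`. -/
def secondFundamentalForm (M : Set (Euc N)) (x a b : Euc N) : Euc N :=
  let D := dirDeriv M (fun y => proj M y b) x a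
  D - proj M x D

/-- `|B|² = ∑ j l, |B(τ_j, τ_l)|²`. -/
def normSqB (M : Set (Euc N)) (x : Euc N) : ℝ :=
  frameSum M x fun τ => frameSum M x fun σ => ‖secondFundamentalForm M x τ σ‖ ^ 2

/-- The mean curvature vector `H`, the trace of the second fundamental form (without the
factor `1/m`). -/
def meanCurvatureVector (M : Set (Euc N)) (x : Euc N) : Euc N :=
  frameSum M x fun τ => secondFundamentalForm M x τ τ

/-- `n` is a continuous unit normal vector field on `M`. -/
def IsUnitNormalField (M : Set (Euc N)) (n : Euc N → Euc N) : Prop :=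
  ContinuousOn n M ∧ ∀ x ∈ M, n x ∈ (tangentSpace M x)ᗮ ∧ ‖n x‖ = 1

/-- The scalar mean curvature `𝓗 = -∂·n` with respect to a unit normal field `n`. -/
def meanCurvature (M : Set (Euc N)) (n : Euc N → Euc N) (x : Euc N) : ℝ :=
  -divergence M n x

end Shape

end GeomCalc

end

noncomputable section

namespace GeomCalc

variable {N : ℕ}

/-! Everything is expressed through the field P of tangential projections, extended locally to a
smooth operator field p. Write D_a for `projD p x a`, and ∇D for the derivative of `projD p`.
Differentiating the identities that P satisfies on M shows that D_a is symmetric and exchanges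
tangent and normal vectors, that D_a b = B(a,b) = D_b a for tangent a, b, and that (∇D)_{a,b} =
(∇D)_{b,a} (Codazzi).

For tangent a the shape and the shape bivector are both S_a = ∑ τ_l D_a τ_l. Right multiplication of
τ_1 ∧ … ∧ τ_m by τ_l v, with v normal, replaces τ_l by v, so the Leibniz rule for blades says (a·∂)T
= T S_a (`hasFDerivWithinAt_gaussMap`). A second differentiation gives ΔT = T ∑ S_τ² + T ∑ τ ∧ K(τ),
where K = ∑ (∇D)_{τ,τ} is `trace` (`laplaceBeltrami_eq`).

The two sums are then identified. The grade-two part of S_τ² cancels by antisymmetry, so ∑ S_τ² is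
the shape 4-vector minus |B|² (`frameSum_shapeBivector_sq`). By Codazzi, K(a) and (a·∂)H differ by a
symmetric tangential operator, which has no curl, so ∑ τ ∧ K(τ) = ∂∧H (`curl_eq_trace`). Finally T
anticommutes with the bivectors S_a and ∂∧H, which produces the signs (`jacobi_gaussMap`).

For a hypersurface, S_a = v ∧ n kills the 4-vector. Differentiating (a·∂)n = -D_a n once more gives
Δn = -K(n) + ∑ D_τ D_τ n. Here the last sum is |B|² n, and K(n) has tangential part ∂𝓗 and normal
part 2|B|² n (`jacobi_normal`). -/

/-! ### Local smooth extension of the tangential projections. -/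

theorem proj_mem (M : Set (Euc N)) (x v : Euc N) : proj M x v ∈ tangentSpace M x :=
  Submodule.starProjection_apply_mem _ _

theorem proj_of_mem {M : Set (Euc N)} {x v : Euc N} (hv : v ∈ tangentSpace M x) :
    proj M x v = v :=
  Submodule.starProjection_eq_self_iff.2 hv

theorem inner_proj_left (M : Set (Euc N)) (x u v : Euc N) :
    inner ℝ (proj M x u) v = inner ℝ u (proj M x v) :=
  Submodule.inner_starProjection_left_eq_right _ _ _

/-- Functions that agree on `M` near `x` have the same directional derivatives. -/
theorem dirDeriv_congr {V : Type*} [NormedAddCommGroup V] [NormedSpace ℝ V] {M : Set (Euc N)}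
    {F G : Euc N → V} {U : Set (Euc N)} (hU : IsOpen U) {x : Euc N} (hxM : x ∈ M) (hxU : x ∈ U)
    (h : ∀ y ∈ M, y ∈ U → F y = G y) (a : Euc N) : dirDeriv M F x a = dirDeriv M G x a := by
  have : F =ᶠ[nhdsWithin x M] G := by
    filter_upwards [self_mem_nhdsWithin, nhdsWithin_le_nhds (hU.mem_nhds hxU)] with y h1 h2
    exact h y h1 h2
  rw [dirDeriv, dirDeriv, this.fderivWithin_eq (h x hxM hxU)]

theorem hasFDerivWithinAt_congr {V : Type*} [NormedAddCommGroup V] [NormedSpace ℝ V]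
    {M : Set (Euc N)} {F G : Euc N → V} {G' : Euc N →L[ℝ] V} {U : Set (Euc N)} (hU : IsOpen U)
    {x : Euc N} (hxM : x ∈ M) (hxU : x ∈ U) (h : ∀ y ∈ M, y ∈ U → F y = G y)
    (hG : HasFDerivWithinAt G G' M x) : HasFDerivWithinAt F G' M x := by
  refine hG.congr_of_eventuallyEq ?_ (h x hxM hxU)
  filter_upwards [self_mem_nhdsWithin, nhdsWithin_le_nhds (hU.mem_nhds hxU)] with y h1 h2
  exact h y h1 h2

/-- A submanifold is locally the image of a smooth retraction of an open set of `ℝ^N`. -/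
theorem exists_retraction {m : ℕ} {M : Set (Euc N)} (hM : IsSmoothSubmanifold m M) {x : Euc N}
    (hx : x ∈ M) : ∃ (U : Set (Euc N)) (r : Euc N → Euc N), IsOpen U ∧ x ∈ U ∧
      ContDiffOn ℝ ∞ r U ∧ (∀ y ∈ U, r y ∈ M) ∧ ∀ y ∈ M, y ∈ U → r y = y := by
  obtain ⟨Φ, W, hxs, h1, h2, -, h4⟩ := hM x hx
  have hW : ∀ y ∈ Φ.source, y ∈ M → W.starProjection (Φ y) = Φ y := fun y hy hyM =>
    Submodule.starProjection_eq_self_iff.2 ((h4 y hy).1 hyM)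
  -- In the chart the retraction is the linear projection onto W; the open set consists of the
  -- points whose projected image is still in the chart.
  refine ⟨Φ.source ∩ Φ ⁻¹' (W.starProjection ⁻¹' Φ.target),
    fun y => Φ.symm (W.starProjection (Φ y)), ?_, ⟨hxs, ?_⟩, ?_, ?_, ?_⟩
  · exact Φ.continuousOn.isOpen_inter_preimage Φ.open_source
      (Φ.open_target.preimage W.starProjection.continuous)
  · simp only [Set.mem_preimage, hW x hxs hx]
    exact Φ.map_source hxs
  · exact h2.comp (W.starProjection.contDiff.comp_contDiffOn (h1.mono Set.inter_subset_left))
      fun y hy => hy.2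
  · rintro y ⟨hy1, hy2⟩
    refine (h4 _ (Φ.map_target hy2)).2 ?_
    rw [Φ.right_inv hy2]
    exact Submodule.starProjection_apply_mem _ _
  · rintro y hyM ⟨hy1, hy2⟩
    simp only [hW y hy1 hyM, Φ.left_inv hy1]

/-- The map r sends the open set U into M, so its differential sends the tangent cone of U, which is
the whole space, into that of M. -/
theorem fderiv_retraction_mem {M U : Set (Euc N)} {r : Euc N → Euc N} (hU : IsOpen U)
    (hr : ContDiffOn ℝ ∞ r U) (hrM : ∀ y ∈ U, r y ∈ M) (hid : ∀ y ∈ M, y ∈ U → r y = y)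
    {y : Euc N} (hyM : y ∈ M) (hyU : y ∈ U) (v : Euc N) :
    fderiv ℝ r y v ∈ tangentSpace M y := by
  have hd : HasFDerivAt r (fderiv ℝ r y) y :=
    ((hr.contDiffAt (hU.mem_nhds hyU)).differentiableAt (by simp)).hasFDerivAt
  have hv : v ∈ tangentConeAt ℝ U y := by
    rw [tangentConeAt_of_mem_nhds (hU.mem_nhds hyU)]; trivial
  have h := (hd.hasFDerivWithinAt (s := U)).mapsTo_tangent_cone hv
  rw [hid y hyM hyU] at h
  refine Submodule.subset_span (tangentConeAt_mono ?_ h)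
  rintro _ ⟨z, hz, rfl⟩
  exact hrM z hz

theorem fderiv_retraction_of_mem {M U : Set (Euc N)} {r : Euc N → Euc N} (hU : IsOpen U)
    (hr : ContDiffOn ℝ ∞ r U) (hid : ∀ y ∈ M, y ∈ U → r y = y)
    {y : Euc N} (hyM : y ∈ M) (hyU : y ∈ U) {a : Euc N} (ha : a ∈ tangentSpace M y) :
    fderiv ℝ r y a = a := by
  have hd : HasFDerivAt r (fderiv ℝ r y) y :=
    ((hr.contDiffAt (hU.mem_nhds hyU)).differentiableAt (by simp)).hasFDerivAt
  rw [← dirDeriv_eq hd.hasFDerivWithinAt ha, dirDeriv_congr hU hyM hyU hid,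
    dirDeriv_eq (F := fun y => y) (hasFDerivWithinAt_id y M) ha]
  rfl

/-- `1 + R - R*` is invertible for every linear operator `R`. -/
theorem isUnit_one_add_sub_adjoint (R : Euc N →L[ℝ] Euc N) :
    IsUnit (1 + R - ContinuousLinearMap.adjoint R) := by
  rw [ContinuousLinearMap.isUnit_iff_isUnit_toLinearMap, LinearMap.isUnit_iff_ker_eq_bot,
    LinearMap.ker_eq_bot']
  intro v hv
  -- R - R* is skew, so pairing with v leaves only |v|².
  have h : inner ℝ v ((1 + R - ContinuousLinearMap.adjoint R) v) = (0 : ℝ) := by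
    rw [show (1 + R - ContinuousLinearMap.adjoint R) v = 0 from hv, inner_zero_right]
  simp only [sub_apply, add_apply,
    one_apply_eq_self, inner_sub_right, inner_add_right,
    ContinuousLinearMap.adjoint_inner_right] at h
  rw [real_inner_comm (R v) v] at h
  simpa using h

/-- The orthogonal projection onto the range of a projection `R` is `R (1 + R - R*)⁻¹`. -/
theorem starProjection_eq_mul_inverse (K : Submodule ℝ (Euc N)) (R : Euc N →L[ℝ] Euc N)
    (h1 : ∀ v, R v ∈ K) (h2 : ∀ v ∈ K, R v = v) :
    R * Ring.inverse (1 + R - ContinuousLinearMap.adjoint R) = K.starProjection := by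
  have hRP : R * K.starProjection = K.starProjection := by
    ext1 v; exact h2 _ (Submodule.starProjection_apply_mem _ _)
  have hPR : K.starProjection * R = R := by
    ext1 v; exact Submodule.starProjection_eq_self_iff.2 (h1 v)
  have hPRs : K.starProjection * ContinuousLinearMap.adjoint R = K.starProjection := by
    have h := congrArg ContinuousLinearMap.adjoint hRP
    have hs : ContinuousLinearMap.adjoint K.starProjection = K.starProjection :=
      isSelfAdjoint_starProjection K
    rw [← ContinuousLinearMap.star_eq_adjoint, star_mul, ContinuousLinearMap.star_eq_adjoint,
      ContinuousLinearMap.star_eq_adjoint, hs] at h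
    exact h
  -- With P the orthogonal projection, PR = R and PR* = (RP)* = P, so P(1 + R - R*) = P + R - P.
  have h : K.starProjection * (1 + R - ContinuousLinearMap.adjoint R) = R := by
    rw [mul_sub, mul_add, hPR, hPRs, mul_one, add_sub_cancel_left]
  conv_lhs => rw [← h]
  rw [h]
  nth_rewrite 1 [← h]
  rw [mul_assoc, Ring.mul_inverse_cancel _ (isUnit_one_add_sub_adjoint R), mul_one]

/-- `p` is a smooth extension to the open set `U` of the field of tangential projections of `M`,
whose second fundamental form is symmetric. -/
structure IsProjExtension (M U : Set (Euc N)) (p : Euc N → Euc N →L[ℝ] Euc N) : Prop where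
  isOpen : IsOpen U
  smooth : ContDiffOn ℝ ∞ p U
  eq_proj : ∀ y ∈ M, y ∈ U → p y = proj M y
  symm : ∀ y ∈ M, y ∈ U → ∀ a ∈ tangentSpace M y, ∀ b ∈ tangentSpace M y,
    fderiv ℝ p y a b = fderiv ℝ p y b a

/-- The differential R of a retraction projects onto the tangent space at points of M, though not
orthogonally; R(1 + R - R*)⁻¹ corrects this and stays smooth. The symmetry of B comes from that of
the second derivative of r. -/
theorem exists_isProjExtension {m : ℕ} {M : Set (Euc N)} (hM : IsSmoothSubmanifold m M)
    {x : Euc N} (hx : x ∈ M) : ∃ U p, x ∈ U ∧ IsProjExtension M U p := by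
  obtain ⟨U, r, hU, hxU, hr, hrM, hid⟩ := exists_retraction hM hx
  set R : Euc N → Euc N →L[ℝ] Euc N := fderiv ℝ r with hR
  have hRs : ContDiffOn ℝ ∞ R U := hr.fderiv_of_isOpen hU (by simp)
  set p : Euc N → Euc N →L[ℝ] Euc N := fun y =>
    R y * Ring.inverse (1 + R y - ContinuousLinearMap.adjoint (R y)) with hp
  have hps : ContDiffOn ℝ ∞ p U := by
    intro y hy
    have hRy : ContDiffAt ℝ ∞ R y := hRs.contDiffAt (hU.mem_nhds hy)
    have hA : ContDiffAt ℝ ∞ (fun y => 1 + R y - ContinuousLinearMap.adjoint (R y)) y :=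
      (contDiffAt_const.add hRy).sub
        ((ContinuousLinearMap.adjoint (𝕜 := ℝ) (E := Euc N)
          (F := Euc N)).toContinuousLinearEquiv.contDiff.contDiffAt.comp y hRy)
    obtain ⟨u, hu⟩ := isUnit_one_add_sub_adjoint (R y)
    have hinv : ContDiffAt ℝ ∞ Ring.inverse (1 + R y - ContinuousLinearMap.adjoint (R y)) := by
      rw [← hu]; exact contDiffAt_ringInverse ℝ u
    exact (hRy.mul (hinv.comp y hA)).contDiffWithinAt
  have hpp : ∀ y ∈ M, y ∈ U → p y = proj M y := fun y hyM hyU =>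
    starProjection_eq_mul_inverse _ _ (fderiv_retraction_mem hU hr hrM hid hyM hyU)
      fun v hv => fderiv_retraction_of_mem hU hr hid hyM hyU hv
  refine ⟨U, p, hxU, hU, hps, hpp, fun y hyM hyU => ?_⟩
  have hpd : HasFDerivAt p (fderiv ℝ p y) y :=
    ((hps.contDiffAt (hU.mem_nhds hyU)).differentiableAt (by simp)).hasFDerivAt
  have hRd : HasFDerivAt R (fderiv ℝ R y) y :=
    ((hRs.contDiffAt (hU.mem_nhds hyU)).differentiableAt (by simp)).hasFDerivAt
  -- Differentiating P(Rb) = Rb along M, with Rb = b at the point, shows that p'(a)b is the normal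
  -- part of r''(a,b).
  have key : ∀ a ∈ tangentSpace M y, ∀ b ∈ tangentSpace M y,
      fderiv ℝ p y a b = fderiv ℝ R y a b - p y (fderiv ℝ R y a b) := by
    intro a ha b hb
    have hRb : HasFDerivAt (fun z => R z b) ((fderiv ℝ R y).flip b) y := by
      simpa using hRd.clm_apply (hasFDerivAt_const b y)
    have e1 := dirDeriv_eq (hpd.clm_apply hRb).hasFDerivWithinAt ha
    have e2 := dirDeriv_eq (M := M) hRb.hasFDerivWithinAt ha
    have e3 : ∀ z ∈ M, z ∈ U → p z (R z b) = R z b := fun z hzM hzU => by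
      rw [hpp z hzM hzU]
      exact proj_of_mem (fderiv_retraction_mem hU hr hrM hid hzM hzU b)
    rw [dirDeriv_congr hU hyM hyU e3, e2] at e1
    have e4 : R y b = b := fderiv_retraction_of_mem hU hr hid hyM hyU hb
    simp [e4] at e1
    rw [eq_sub_iff_add_eq, add_comm]; exact e1.symm
  have hsymm : IsSymmSndFDerivAt ℝ r y :=
    (hr.contDiffAt (hU.mem_nhds hyU)).isSymmSndFDerivAt
      (by simpa using (mod_cast le_top : ((2 : ℕ∞) : WithTop ℕ∞) ≤ ∞))
  intro a ha b hb
  rw [key a ha b hb, key b hb a ha, hsymm.eq a b]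

/-! ### Clifford products of vectors and blades. -/

/-- This is uA = u ∧ A + u ⌟ A. The change of form subtracts the contraction by the form associated
with -Q, hence the plus sign. -/
theorem toExt_vec_mul (u : Euc N) (A : GA N) :
    toExt N (vec u * A) =
      ExteriorAlgebra.ι ℝ u * toExt N A
        + CliffordAlgebra.contractLeft (Q := (0 : QuadraticForm ℝ (Euc N))) (innerₗ (Euc N) u)
            (toExt N A) := by
  have h :=
  CliffordAlgebra.changeForm_ι_mul
    (CliffordAlgebra.changeForm.associated_neg_proof (Q := sqForm N)) u A
  have hB : QuadraticMap.associated (R := ℝ) (M := Euc N) (-(sqForm N)) u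
      = -(innerₗ (Euc N) u) := by
    ext v
    simp only [map_neg, LinearMap.neg_apply, QuadraticMap.associated_apply,
      LinearMap.BilinMap.toQuadraticMap_apply, innerₗ_apply_apply, inner_add_left,
      inner_add_right, real_inner_comm u v, sqForm]
    simp
    ring
  rw [show innerₗ (Euc N) u = -(QuadraticMap.associated (R := ℝ) (M := Euc N) (-(sqForm N)) u) by
    rw [hB, neg_neg], map_neg, LinearMap.neg_apply, ← sub_eq_add_neg]
  exact h

theorem toExt_one : toExt N 1 = 1 :=
  CliffordAlgebra.changeForm_one (CliffordAlgebra.changeForm.associated_neg_proof (Q := sqForm N))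

theorem toExt_algebraMap (r : ℝ) : toExt N (algebraMap ℝ _ r) = algebraMap ℝ _ r :=
  CliffordAlgebra.changeForm_algebraMap
    (CliffordAlgebra.changeForm.associated_neg_proof (Q := sqForm N)) r

theorem toExt_vec (u : Euc N) : toExt N (vec u) = ExteriorAlgebra.ι ℝ u :=
  CliffordAlgebra.changeForm_ι (CliffordAlgebra.changeForm.associated_neg_proof (Q := sqForm N)) u

theorem vec_mul_self (u : Euc N) : vec u * vec u = algebraMap ℝ (GA N) (inner ℝ u u) :=
  CliffordAlgebra.ι_sq_scalar _ u

theorem vec_mul_vec_of_inner_eq_zero {u v : Euc N} (h : inner ℝ u v = (0 : ℝ)) :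
    vec u * vec v = -(vec v * vec u) := by
  rw [eq_neg_iff_add_eq_zero]
  refine CliffordAlgebra.ι_mul_ι_add_swap_of_isOrtho ?_
  simp [QuadraticMap.IsOrtho, sqForm, inner_add_right, h, real_inner_comm u v]

theorem wedge_vec_vec {u v : Euc N} (h : inner ℝ u v = (0 : ℝ)) :
    wedge (vec u) (vec v) = vec u * vec v := by
  apply (toExt N).injective
  rw [wedge, LinearEquiv.apply_symm_apply, toExt_vec_mul, toExt_vec, toExt_vec]
  have : CliffordAlgebra.contractLeft (Q := (0 : QuadraticForm ℝ (Euc N))) (innerₗ (Euc N) u)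
      (ExteriorAlgebra.ι ℝ v) = 0 := by
    rw [ExteriorAlgebra.ι, CliffordAlgebra.contractLeft_ι]; simp [h]
  rw [this, add_zero]

theorem contractLeft_ιMulti_eq_zero {m : ℕ} {v : Euc N} {a : Fin m → Euc N}
    (h : ∀ j, inner ℝ v (a j) = (0 : ℝ)) :
    CliffordAlgebra.contractLeft (Q := (0 : QuadraticForm ℝ (Euc N))) (innerₗ (Euc N) v)
      (ExteriorAlgebra.ιMulti ℝ m a) = 0 := by
  induction m with
  | zero =>
    rw [ExteriorAlgebra.ιMulti_zero_apply]; exact CliffordAlgebra.contractLeft_one (Q := 0) _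
  | succ m ih =>
    rw [ExteriorAlgebra.ιMulti_succ_apply]
    refine (CliffordAlgebra.contractLeft_ι_mul _ _ _).trans ?_
    have := ih (a := Matrix.vecTail a) fun j => h j.succ
    rw [this]
    simp [h]

theorem vec_mul_blade {m : ℕ} {v : Euc N} {a : Fin m → Euc N}
    (h : ∀ j, inner ℝ v (a j) = (0 : ℝ)) :
    vec v * blade a = blade (Fin.cons v a : Fin (m + 1) → Euc N) := by
  apply (toExt N).injective
  rw [toExt_vec_mul, blade, blade, LinearEquiv.apply_symm_apply, LinearEquiv.apply_symm_apply,
    contractLeft_ιMulti_eq_zero h, add_zero, ExteriorAlgebra.ιMulti_succ_apply]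
  rfl

theorem blade_succ {m : ℕ} {a : Fin (m + 1) → Euc N}
    (h : ∀ j : Fin m, inner ℝ (a 0) (a j.succ) = (0 : ℝ)) :
    blade a = vec (a 0) * blade (fun j => a j.succ) := by
  rw [vec_mul_blade h]
  congr 1
  exact (Fin.cons_self_tail a).symm

theorem blade_zero (a : Fin 0 → Euc N) : blade a = 1 := by
  apply (toExt N).injective
  rw [blade, LinearEquiv.apply_symm_apply, ExteriorAlgebra.ιMulti_zero_apply, toExt_one]

theorem blade_mul_vec {m : ℕ} {v : Euc N} {a : Fin m → Euc N}
    (ha : Pairwise fun i j => inner ℝ (a i) (a j) = (0 : ℝ))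
    (h : ∀ j, inner ℝ v (a j) = (0 : ℝ)) :
    blade a * vec v = (-1 : ℝ) ^ m • (vec v * blade a) := by
  induction m with
  | zero => simp [blade_zero]
  | succ m ih =>
    have h0 : ∀ j : Fin m, inner ℝ (a 0) (a j.succ) = (0 : ℝ) :=
      fun j => ha (Fin.succ_ne_zero j).symm
    rw [blade_succ h0, mul_assoc,
      ih (a := fun j => a j.succ) (fun i j hij => ha (by simpa using hij)) (fun j => h j.succ),
      mul_smul_comm, ← mul_assoc, ← mul_assoc, vec_mul_vec_of_inner_eq_zero (h 0), pow_succ,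
      mul_smul]
    simp

/-- The vector a_l anticommutes with the m - 1 other factors and commutes with itself; the exponent
m + 1 has the same parity as m - 1. -/
theorem blade_mul_vec_self {m : ℕ} {a : Fin m → Euc N}
    (ha : Pairwise fun i j => inner ℝ (a i) (a j) = (0 : ℝ)) (l : Fin m) :
    blade a * vec (a l) = (-1 : ℝ) ^ (m + 1) • (vec (a l) * blade a) := by
  induction m with
  | zero => exact l.elim0
  | succ m ih =>
    have h0 : ∀ j : Fin m, inner ℝ (a 0) (a j.succ) = (0 : ℝ) :=
      fun j => ha (Fin.succ_ne_zero j).symm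
    have hs : Pairwise fun i j : Fin m => inner ℝ (a i.succ) (a j.succ) = (0 : ℝ) :=
      fun i j hij => ha (by simpa using hij)
    rw [blade_succ h0, mul_assoc]
    refine Fin.cases ?_ (fun l => ?_) l
    · rw [blade_mul_vec hs h0, mul_smul_comm, pow_succ, pow_succ]
      simp
    · rw [ih hs l, mul_smul_comm, ← mul_assoc, ← mul_assoc,
        vec_mul_vec_of_inner_eq_zero (h0 l), pow_succ _ (m + 1), mul_smul]
      simp

/-- Moving a_l back to its own place, where a_l² = 1, and v into the vacated slot crosses the same
vectors, so the signs cancel. This is what turns a Leibniz derivative of a blade into a product with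
a bivector. -/
theorem blade_mul_vec_mul_vec {m : ℕ} {v : Euc N} {a : Fin m → Euc N} (ha : Orthonormal ℝ a)
    (h : ∀ j, inner ℝ v (a j) = (0 : ℝ)) (l : Fin m) :
    blade a * (vec (a l) * vec v) = blade (Function.update a l v) := by
  induction m with
  | zero => exact l.elim0
  | succ m ih =>
    have h0 : ∀ j : Fin m, inner ℝ (a 0) (a j.succ) = (0 : ℝ) :=
      fun j => ha.2 (Fin.succ_ne_zero j).symm
    have hs : Orthonormal ℝ fun j : Fin m => a j.succ := ha.comp _ (Fin.succ_injective m)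
    rw [blade_succ h0, mul_assoc]
    refine Fin.cases ?_ (fun l => ?_) l
    · rw [← mul_assoc (blade _), blade_mul_vec hs.2 h0, smul_mul_assoc, mul_assoc,
        blade_mul_vec hs.2 (fun j => h j.succ), mul_smul_comm, mul_smul_comm,
        mul_smul_comm, smul_smul, ← mul_pow,
        neg_one_mul, neg_neg, one_pow, one_smul, ← mul_assoc, vec_mul_self,
        real_inner_self_eq_norm_sq, ha.1, one_pow, map_one, one_mul,
        vec_mul_blade fun j => h j.succ]
      congr 1
      ext i : 1
      refine Fin.cases ?_ (fun i => ?_) i <;> simp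
    · rw [ih hs (fun j => h j.succ) l, vec_mul_blade]
      · congr 1
        ext i : 1
        refine Fin.cases ?_ (fun i => ?_) i
        · simp [Function.update_of_ne (Fin.succ_ne_zero l).symm]
        · by_cases hil : i = l
          · subst hil; simp
          · rw [Fin.cons_succ, Function.update_of_ne hil,
              Function.update_of_ne (by simpa using hil)]
      · intro j
        by_cases hjl : j = l
        · subst hjl; rw [Function.update_self, real_inner_comm]; exact h 0
        · rw [Function.update_of_ne hjl]; exact h0 j

/-- One factor lies in the span of the blade and the other is orthogonal to it, so the two signs
have opposite parity. -/
theorem blade_mul_bivector {m : ℕ} {v : Euc N} {a : Fin m → Euc N} (ha : Orthonormal ℝ a)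
    (h : ∀ j, inner ℝ v (a j) = (0 : ℝ)) (l : Fin m) :
    blade a * (vec (a l) * vec v) = -(vec (a l) * vec v * blade a) := by
  rw [← mul_assoc, blade_mul_vec_self ha.2 l, smul_mul_assoc, mul_assoc,
    blade_mul_vec ha.2 h, mul_smul_comm, smul_smul, ← pow_add,
    Odd.neg_one_pow ⟨m, by ring⟩, neg_one_smul, mul_assoc]

/-- The square of the unit blades of grade `m`. -/
theorem exists_blade_mul_self (N m : ℕ) : ∃ ε : ℝ, ε * ε = 1 ∧ ∀ a : Fin m → Euc N,
    Orthonormal ℝ a → blade a * blade a = algebraMap ℝ (GA N) ε := by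
  induction m with
  | zero => exact ⟨1, by simp, fun a _ => by simp [blade_zero]⟩
  | succ m ih =>
    obtain ⟨ε, h1, h2⟩ := ih
    refine ⟨(-1) ^ m * ε, ?_, fun a ha => ?_⟩
    · rw [mul_mul_mul_comm, h1, ← mul_pow]; simp
    · have h0 : ∀ j : Fin m, inner ℝ (a 0) (a j.succ) = (0 : ℝ) :=
        fun j => ha.2 (Fin.succ_ne_zero j).symm
      have hs : Orthonormal ℝ fun j : Fin m => a j.succ := ha.comp _ (Fin.succ_injective m)
      rw [blade_succ h0, mul_assoc, ← mul_assoc (blade _), blade_mul_vec hs.2 h0,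
        smul_mul_assoc, mul_smul_comm, mul_assoc, h2 _ hs, ← mul_assoc, vec_mul_self,
        real_inner_self_eq_norm_sq, ha.1, one_pow, map_one, one_mul, Algebra.smul_def, map_mul]

/-- The exterior product as a bilinear map. -/
def wedgeₗ (N : ℕ) : GA N →ₗ[ℝ] GA N →ₗ[ℝ] GA N :=
  ((LinearMap.mul ℝ (ExteriorAlgebra ℝ (Euc N))).compl₁₂ (toExt N).toLinearMap
    (toExt N).toLinearMap).compr₂ (toExt N).symm.toLinearMap

theorem wedgeₗ_apply (A B : GA N) : wedgeₗ N A B = wedge A B := rfl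

theorem wedge_sum_sum {ι : Type*} (s : Finset ι) (f g : ι → GA N) :
    wedge (∑ i ∈ s, f i) (∑ j ∈ s, g j) = ∑ i ∈ s, ∑ j ∈ s, wedge (f i) (g j) := by
  simp only [← wedgeₗ_apply, map_sum, LinearMap.sum_apply]
  exact Finset.sum_comm

/-- Two applications of `toExt_vec_mul`; the orthogonality relations leave only the contractions of
u with w and of t with v. It serves for t, v tangent and u, w normal. -/
theorem wedge_bivector_bivector {t u v w : Euc N} (h1 : inner ℝ t u = (0 : ℝ))
    (h2 : inner ℝ t w = (0 : ℝ)) (h3 : inner ℝ v u = (0 : ℝ)) (h4 : inner ℝ v w = (0 : ℝ)) :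
    vec t * vec u * (vec v * vec w) = wedge (vec t * vec u) (vec v * vec w)
      - inner ℝ u w • wedge (vec t) (vec v)
      - inner ℝ t v • (wedge (vec u) (vec w) + algebraMap ℝ (GA N) (inner ℝ u w)) := by
  have hι : ∀ d x : Euc N,
      CliffordAlgebra.contractLeft (Q := (0 : QuadraticForm ℝ (Euc N))) (innerₗ (Euc N) d)
        (ExteriorAlgebra.ι ℝ x) = algebraMap ℝ _ (inner ℝ d x) := fun d x => by
    rw [ExteriorAlgebra.ι, CliffordAlgebra.contractLeft_ι]; rfl
  have hm : ∀ (d x : Euc N) (A : ExteriorAlgebra ℝ (Euc N)),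
      CliffordAlgebra.contractLeft (Q := (0 : QuadraticForm ℝ (Euc N))) (innerₗ (Euc N) d)
        (ExteriorAlgebra.ι ℝ x * A) = inner ℝ d x • A - ExteriorAlgebra.ι ℝ x *
        CliffordAlgebra.contractLeft (Q := (0 : QuadraticForm ℝ (Euc N))) (innerₗ (Euc N) d) A :=
    fun d x A => by
      rw [ExteriorAlgebra.ι, CliffordAlgebra.contractLeft_ι_mul]; rfl
  have e1 : toExt N (vec v * vec w) = ExteriorAlgebra.ι ℝ v * ExteriorAlgebra.ι ℝ w := by
    rw [toExt_vec_mul, toExt_vec, hι, h4, map_zero, add_zero]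
  have e2 : toExt N (vec t * vec u) = ExteriorAlgebra.ι ℝ t * ExteriorAlgebra.ι ℝ u := by
    rw [toExt_vec_mul, toExt_vec, hι, h1, map_zero, add_zero]
  have e3 : toExt N (vec u * (vec v * vec w)) = ExteriorAlgebra.ι ℝ u * (ExteriorAlgebra.ι ℝ v *
      ExteriorAlgebra.ι ℝ w) - (inner ℝ u w : ℝ) • ExteriorAlgebra.ι ℝ v := by
    rw [toExt_vec_mul, e1, hm, hι, real_inner_comm v u, h3, zero_smul, zero_sub,
      ← Algebra.commutes, ← Algebra.smul_def, sub_eq_add_neg]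
  apply (toExt N).injective
  rw [mul_assoc, toExt_vec_mul, e3]
  simp only [map_sub, map_add, map_smul, wedge, LinearEquiv.apply_symm_apply, e1, e2, toExt_vec,
    toExt_algebraMap, hm, hι, h1, h2, zero_smul, zero_sub, map_zero, mul_zero, sub_zero]
  simp only [Algebra.algebraMap_eq_smul_one, mul_sub, mul_smul_comm, smul_add, mul_assoc]
  rw [smul_smul, smul_smul, mul_comm (inner ℝ t v : ℝ)]
  abel

/-! ### Sums over frames -/

abbrev stdBasis (N : ℕ) : OrthonormalBasis (Fin N) ℝ (Euc N) := EuclideanSpace.basisFun (Fin N) ℝ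

theorem proj_eq_sum {ι : Type*} [Fintype ι] {M : Set (Euc N)} {x : Euc N}
    (b : OrthonormalBasis ι ℝ (tangentSpace M x)) (v : Euc N) :
    proj M x v = ∑ j, inner ℝ (b j : Euc N) v • (b j : Euc N) := by
  have h1 := b.sum_repr ((tangentSpace M x).orthogonalProjectionOnto v)
  have h2 := congrArg (Submodule.subtype _) h1
  rw [map_sum] at h2
  simp only [map_smul, Submodule.subtype_apply, OrthonormalBasis.repr_apply_apply] at h2
  rw [proj, Submodule.starProjection_apply, ← h2]
  refine Finset.sum_congr rfl fun j _ => ?_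
  rw [Submodule.inner_orthogonalProjectionOnto_eq_of_mem_left]

/-- The contraction of a bilinear map over a frame of the tangent space. -/
theorem sum_frame_eq {V : Type*} [AddCommGroup V] [Module ℝ V] {ι : Type*} [Fintype ι]
    {M : Set (Euc N)} {x : Euc N} (b : OrthonormalBasis ι ℝ (tangentSpace M x))
    (f : Euc N → Euc N → V) (h1 : ∀ v, IsLinearMap ℝ fun u => f u v)
    (h2 : ∀ u, IsLinearMap ℝ (f u)) :
    ∑ j, f (b j) (b j) = ∑ i, f (proj M x (stdBasis N i)) (stdBasis N i) := by
  have e1 : ∀ j, f (b j) (b j)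
      = ∑ i, (inner ℝ (stdBasis N i) (b j : Euc N) : ℝ) • f (b j) (stdBasis N i) := fun j => by
    conv_lhs => rw [← (stdBasis N).sum_repr' (b j : Euc N)]
    have := map_sum
      (IsLinearMap.mk' _ (h2 (∑ i, inner ℝ (stdBasis N i) (b j : Euc N) • stdBasis N i)))
      (fun i => (inner ℝ (stdBasis N i) (b j : Euc N) : ℝ) • stdBasis N i) Finset.univ
    simp only [IsLinearMap.mk'_apply] at this
    rw [this, (stdBasis N).sum_repr' (b j : Euc N)]
    exact Finset.sum_congr rfl fun i _ => (h2 _).map_smul _ _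
  have e2 : ∀ i, f (proj M x (stdBasis N i)) (stdBasis N i)
      = ∑ j, (inner ℝ (stdBasis N i) (b j : Euc N) : ℝ) • f (b j) (stdBasis N i) := fun i => by
    rw [proj_eq_sum b]
    refine (map_sum (IsLinearMap.mk' _ (h1 (stdBasis N i)))
      (fun j => (inner ℝ (b j : Euc N) (stdBasis N i) : ℝ) • (b j : Euc N)) Finset.univ).trans ?_
    refine Finset.sum_congr rfl fun j _ => ?_
    rw [real_inner_comm]
    exact (h1 _).map_smul _ _
  simp only [e1, e2]
  exact Finset.sum_comm

/-- The contraction over a frame does not depend on the frame. -/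
theorem frameSum_eq_sum {V : Type*} [AddCommGroup V] [Module ℝ V] {ι : Type*} [Fintype ι]
    {M : Set (Euc N)} {x : Euc N} (b : OrthonormalBasis ι ℝ (tangentSpace M x))
    (f : Euc N → Euc N → V) (h1 : ∀ v, IsLinearMap ℝ fun u => f u v)
    (h2 : ∀ u, IsLinearMap ℝ (f u)) :
    frameSum M x (fun τ => f τ τ) = ∑ j, f (b j) (b j) := by
  rw [sum_frame_eq b f h1 h2, frameSum, sum_frame_eq (frame M x) f h1 h2]

/-- The frames are chosen point by point, with no regularity. Over a fixed basis of ℝ^N the same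
contraction depends on the point only through P and the bilinear map, so it can be differentiated.
-/
theorem frameSum_eq_sum_stdBasis {V : Type*} [AddCommGroup V] [Module ℝ V]
    (M : Set (Euc N)) (x : Euc N) (f : Euc N → Euc N → V)
    (h1 : ∀ v, IsLinearMap ℝ fun u => f u v) (h2 : ∀ u, IsLinearMap ℝ (f u)) :
    frameSum M x (fun τ => f τ τ) = ∑ i, f (proj M x (stdBasis N i)) (stdBasis N i) :=
  sum_frame_eq (frame M x) f h1 h2

theorem frameSum_congr {V : Type*} [AddCommMonoid V] {M : Set (Euc N)} {x : Euc N}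
    {f g : Euc N → V} (h : ∀ τ ∈ tangentSpace M x, f τ = g τ) :
    frameSum M x f = frameSum M x g :=
  Finset.sum_congr rfl fun j _ => h _ (frame M x j).2

theorem orthonormal_coe {ι : Type*} [Fintype ι] {K : Submodule ℝ (Euc N)}
    (b : OrthonormalBasis ι ℝ K) : Orthonormal ℝ fun j => (b j : Euc N) :=
  b.orthonormal.comp_linearIsometry K.subtypeₗᵢ

/-! ### Products of bivectors and grades -/

theorem wedge_vec_self (u : Euc N) : wedge (vec u) (vec u) = 0 := by
  rw [wedge, toExt_vec, ExteriorAlgebra.ι_sq_zero, map_zero]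

theorem wedge_vec_swap (u v : Euc N) : wedge (vec u) (vec v) = -wedge (vec v) (vec u) := by
  rw [wedge, wedge, toExt_vec, toExt_vec, ← map_neg, eq_neg_of_add_eq_zero_left
    (ExteriorAlgebra.ι_add_mul_swap u v)]

/-- The square of a bivector `∑ τ_l B_l`, where the `τ_l` are orthonormal and orthogonal to
the `B_l`. -/
theorem sum_bivector_mul_self {ι : Type*} [Fintype ι] {τ B : ι → Euc N} (hτ : Orthonormal ℝ τ)
    (h : ∀ l k, inner ℝ (τ l) (B k) = (0 : ℝ)) :
    (∑ l, vec (τ l) * vec (B l)) * (∑ l, vec (τ l) * vec (B l))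
      = wedge (∑ l, vec (τ l) * vec (B l)) (∑ l, vec (τ l) * vec (B l))
        - (∑ l, ‖B l‖ ^ 2) • (1 : GA N) := by
  classical
  -- Symmetric coefficients against an antisymmetric product.
  have h0 : ∑ l, ∑ k, (inner ℝ (B l) (B k) : ℝ) • wedge (vec (τ l)) (vec (τ k)) = 0 := by
    have h1 : ∑ l, ∑ k, (inner ℝ (B l) (B k) : ℝ) • wedge (vec (τ l)) (vec (τ k))
        = -∑ l, ∑ k, (inner ℝ (B l) (B k) : ℝ) • wedge (vec (τ l)) (vec (τ k)) := by
      conv_lhs => rw [Finset.sum_comm]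
      simp only [← Finset.sum_neg_distrib]
      refine Finset.sum_congr rfl fun l _ => Finset.sum_congr rfl fun k _ => ?_
      rw [real_inner_comm, wedge_vec_swap, smul_neg]
    have h2 : (2 : ℝ) •
        ∑ l, ∑ k, (inner ℝ (B l) (B k) : ℝ) • wedge (vec (τ l)) (vec (τ k)) = 0 := by
      rw [two_smul]; nth_rewrite 1 [h1]; exact neg_add_cancel _
    exact (smul_eq_zero.1 h2).resolve_left two_ne_zero
  rw [wedge_sum_sum, Finset.sum_mul_sum]
  simp only [wedge_bivector_bivector (h _ _) (h _ _) (h _ _) (h _ _), Finset.sum_sub_distrib, h0,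
    sub_zero]
  congr 1
  -- Orthonormality of τ leaves the diagonal terms, where B_l ∧ B_l = 0 and only the scalars |B_l|²
  -- survive.
  simp only [orthonormal_iff_ite.1 hτ, ite_smul, one_smul, zero_smul, Finset.sum_ite_eq,
    Finset.mem_univ, if_true, wedge_vec_self, zero_add, real_inner_self_eq_norm_sq,
    Algebra.algebraMap_eq_smul_one, ← Finset.sum_smul]

/-- The grade projection as a linear map. -/
def gradePartₗ (N r : ℕ) : GA N →ₗ[ℝ] GA N :=
  (toExt N).symm.toLinearMap ∘ₗ
    (GradedAlgebra.proj (fun i : ℕ => ⋀[ℝ]^i (Euc N)) r : _ →ₗ[ℝ] _) ∘ₗ (toExt N).toLinearMap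

theorem gradePartₗ_apply (r : ℕ) (A : GA N) : gradePartₗ N r A = gradePart r A := rfl

theorem gradePart_blade {m : ℕ} (a : Fin m → Euc N) : gradePart m (blade a) = blade a := by
  rw [gradePart, blade, LinearEquiv.apply_symm_apply, GradedAlgebra.proj_apply,
    DirectSum.decompose_of_mem_same]
  rw [← ExteriorAlgebra.ιMulti_span_fixedDegree]
  exact Submodule.subset_span ⟨a, rfl⟩

/-! ### Continuous products and the derivative of the projection field. -/

instance : FiniteDimensional ℝ (GA N) := (coords N).symm.finiteDimensional

/-- The geometric product as a continuous bilinear map. -/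
def mulL (N : ℕ) : GA N →L[ℝ] GA N →L[ℝ] GA N :=
  (LinearMap.mul ℝ (GA N)).toContinuousBilinearMap

theorem mulL_apply (A B : GA N) : mulL N A B = A * B := rfl

/-- The blade `u ∧ v` as a continuous bilinear map. -/
def wedgeVecL (N : ℕ) : Euc N →L[ℝ] Euc N →L[ℝ] GA N :=
  ((wedgeₗ N).compl₁₂ (CliffordAlgebra.ι (sqForm N))
    (CliffordAlgebra.ι (sqForm N))).toContinuousBilinearMap

theorem wedgeVecL_apply (u v : Euc N) : wedgeVecL N u v = wedge (vec u) (vec v) := rfl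

/-- The derivative `((p_y b)·∂)p` of a field of operators. -/
def projD (p : Euc N → Euc N →L[ℝ] Euc N) (y : Euc N) : Euc N →L[ℝ] Euc N →L[ℝ] Euc N :=
  (fderiv ℝ p y).comp (p y)

theorem projD_apply (p : Euc N → Euc N →L[ℝ] Euc N) (y b : Euc N) :
    projD p y b = fderiv ℝ p y (p y b) := rfl

/-- The device for differentiating an identity that holds only on M: extensions may disagree off M,
but their derivatives agree in tangent directions. -/
theorem fderiv_eq_of_eqOn {V : Type*} [NormedAddCommGroup V] [NormedSpace ℝ V]
    {M U : Set (Euc N)} (hU : IsOpen U) {x : Euc N} (hxM : x ∈ M) (hxU : x ∈ U)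
    {F G : Euc N → V} {F' G' : Euc N →L[ℝ] V} (hF : HasFDerivAt F F' x) (hG : HasFDerivAt G G' x)
    (h : ∀ y ∈ M, y ∈ U → F y = G y) {a : Euc N} (ha : a ∈ tangentSpace M x) : F' a = G' a := by
  rw [← dirDeriv_eq hF.hasFDerivWithinAt ha, ← dirDeriv_eq hG.hasFDerivWithinAt ha,
    dirDeriv_congr hU hxM hxU h]

/-! ### Differentiated identities of the projection field. -/

namespace IsProjExtension

variable {M U : Set (Euc N)} {p : Euc N → Euc N →L[ℝ] Euc N} {x : Euc N}

theorem hasFDerivAt (hp : IsProjExtension M U p) (hxU : x ∈ U) :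
    HasFDerivAt p (fderiv ℝ p x) x :=
  ((hp.smooth.contDiffAt (hp.isOpen.mem_nhds hxU)).differentiableAt (by simp)).hasFDerivAt

theorem hasFDerivAt_fderiv (hp : IsProjExtension M U p) (hxU : x ∈ U) :
    HasFDerivAt (fderiv ℝ p) (fderiv ℝ (fderiv ℝ p) x) x := by
  have h : ContDiffOn ℝ ∞ (fderiv ℝ p) U := hp.smooth.fderiv_of_isOpen hp.isOpen (by simp)
  exact ((h.contDiffAt (hp.isOpen.mem_nhds hxU)).differentiableAt (by simp)).hasFDerivAt

theorem hasFDerivAt_projD (hp : IsProjExtension M U p) (hxU : x ∈ U) :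
    HasFDerivAt (projD p) (fderiv ℝ (projD p) x) x :=
  ((hp.hasFDerivAt_fderiv hxU).clm_comp
    (hp.hasFDerivAt hxU)).differentiableAt.hasFDerivAt

theorem fderiv_projD (hp : IsProjExtension M U p) (hxU : x ∈ U) (a b : Euc N) :
    fderiv ℝ (projD p) x a b
      = fderiv ℝ (fderiv ℝ p) x a (p x b) + fderiv ℝ p x (fderiv ℝ p x a b) := by
  have h : fderiv ℝ (projD p) x = _ :=
    ((hp.hasFDerivAt_fderiv hxU).clm_comp (hp.hasFDerivAt hxU)).fderiv
  rw [h]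
  exact add_comm (fderiv ℝ p x (fderiv ℝ p x a b)) _

theorem apply_mem (hp : IsProjExtension M U p) (hxM : x ∈ M) (hxU : x ∈ U) (v : Euc N) :
    p x v ∈ tangentSpace M x := by
  rw [hp.eq_proj x hxM hxU]; exact proj_mem M x v

theorem apply_of_mem (hp : IsProjExtension M U p) (hxM : x ∈ M) (hxU : x ∈ U) {v : Euc N}
    (hv : v ∈ tangentSpace M x) : p x v = v := by
  rw [hp.eq_proj x hxM hxU]; exact proj_of_mem hv

theorem apply_apply (hp : IsProjExtension M U p) (hxM : x ∈ M) (hxU : x ∈ U) (v : Euc N) :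
    p x (p x v) = p x v :=
  hp.apply_of_mem hxM hxU (hp.apply_mem hxM hxU v)

theorem inner_apply_left (hp : IsProjExtension M U p) (hxM : x ∈ M) (hxU : x ∈ U)
    (u v : Euc N) : inner ℝ (p x u) v = (inner ℝ u (p x v) : ℝ) := by
  rw [hp.eq_proj x hxM hxU]; exact inner_proj_left M x u v

theorem projD_of_mem (hp : IsProjExtension M U p) (hxM : x ∈ M) (hxU : x ∈ U) {a : Euc N}
    (ha : a ∈ tangentSpace M x) : projD p x a = fderiv ℝ p x a := by
  rw [projD_apply, hp.apply_of_mem hxM hxU ha]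

theorem projD_apply_left (hp : IsProjExtension M U p) (hxM : x ∈ M) (hxU : x ∈ U) (a : Euc N) :
    projD p x (p x a) = projD p x a := by
  rw [projD_apply, hp.apply_apply hxM hxU, projD_apply]

theorem projD_symm (hp : IsProjExtension M U p) (hxM : x ∈ M) (hxU : x ∈ U) (a b : Euc N) :
    projD p x a (p x b) = projD p x b (p x a) :=
  hp.symm x hxM hxU _ (hp.apply_mem hxM hxU a) _ (hp.apply_mem hxM hxU b)

/-- The derivative of P² = P. -/
theorem projD_add (hp : IsProjExtension M U p) (hxM : x ∈ M) (hxU : x ∈ U) (a v : Euc N) :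
    projD p x a (p x v) + p x (projD p x a v) = projD p x a v := by
  have h1 := hp.hasFDerivAt hxU
  have h2 := h1.clm_apply (hasFDerivAt_const v x)
  have h := fderiv_eq_of_eqOn hp.isOpen hxM hxU (h1.clm_apply h2) h2
    (fun y hy hyU => hp.apply_apply hy hyU v) (hp.apply_mem hxM hxU a)
  simp only [ContinuousLinearMap.comp_zero, add_apply, zero_add,
    ContinuousLinearMap.comp_apply, ContinuousLinearMap.flip_apply] at h
  rw [add_comm]; exact h

/-- The derivative of the self-adjointness of P. -/
theorem inner_projD (hp : IsProjExtension M U p) (hxM : x ∈ M) (hxU : x ∈ U) (a u v : Euc N) :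
    inner ℝ (projD p x a u) v = (inner ℝ u (projD p x a v) : ℝ) := by
  have h1 := hp.hasFDerivAt hxU
  have h2 := h1.clm_apply (hasFDerivAt_const u x)
  have h3 := h1.clm_apply (hasFDerivAt_const v x)
  have h := fderiv_eq_of_eqOn hp.isOpen hxM hxU (h2.inner ℝ (hasFDerivAt_const v x))
    ((hasFDerivAt_const u x).inner ℝ h3)
    (fun y hy hyU => hp.inner_apply_left hy hyU u v) (hp.apply_mem hxM hxU a)
  simpa [projD_apply] using h

/-- The operators `projD p x a` exchange tangent and normal vectors. -/
theorem apply_projD_apply (hp : IsProjExtension M U p) (hxM : x ∈ M) (hxU : x ∈ U)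
    (a v : Euc N) : p x (projD p x a (p x v)) = 0 := by
  have h := hp.projD_add hxM hxU a (p x v)
  rw [hp.apply_apply hxM hxU] at h
  simpa using h

theorem apply_projD_of_apply_eq_zero (hp : IsProjExtension M U p) (hxM : x ∈ M) (hxU : x ∈ U)
    (a : Euc N) {v : Euc N} (hv : p x v = 0) : p x (projD p x a v) = projD p x a v := by
  simpa [hv] using hp.projD_add hxM hxU a v

theorem apply_projD_projD (hp : IsProjExtension M U p) (hxM : x ∈ M) (hxU : x ∈ U)
    (a b v : Euc N) :
    p x (projD p x a (projD p x b (p x v))) = projD p x a (projD p x b (p x v)) :=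
  hp.apply_projD_of_apply_eq_zero hxM hxU a (hp.apply_projD_apply hxM hxU b v)

/-- The Codazzi equation. -/
theorem fderiv_projD_comm (hp : IsProjExtension M U p) (hxM : x ∈ M) (hxU : x ∈ U) {a b : Euc N}
    (ha : a ∈ tangentSpace M x) (hb : b ∈ tangentSpace M x) :
    fderiv ℝ (projD p) x a b = fderiv ℝ (projD p) x b a := by
  have hs : IsSymmSndFDerivAt ℝ p x :=
    (hp.smooth.contDiffAt (hp.isOpen.mem_nhds hxU)).isSymmSndFDerivAt
      (by simpa using (mod_cast le_top : ((2 : ℕ∞) : WithTop ℕ∞) ≤ ∞))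
  -- Both terms of p''(a,b) + p'(p'(a)b) are symmetric: the first as a second derivative, the second
  -- by the symmetry of B.
  rw [hp.fderiv_projD hxU, hp.fderiv_projD hxU, hp.apply_of_mem hxM hxU ha,
    hp.apply_of_mem hxM hxU hb, hs.eq a b, hp.symm x hxM hxU a ha b hb]

theorem inner_fderiv_projD (hp : IsProjExtension M U p) (hxM : x ∈ M) (hxU : x ∈ U) {a : Euc N}
    (ha : a ∈ tangentSpace M x) (b u v : Euc N) :
    inner ℝ (fderiv ℝ (projD p) x a b u) v
      = (inner ℝ u (fderiv ℝ (projD p) x a b v) : ℝ) := by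
  have h1 := (hp.hasFDerivAt_projD hxU).clm_apply (hasFDerivAt_const b x)
  have h2 := h1.clm_apply (hasFDerivAt_const u x)
  have h3 := h1.clm_apply (hasFDerivAt_const v x)
  have h := fderiv_eq_of_eqOn hp.isOpen hxM hxU (h2.inner ℝ (hasFDerivAt_const v x))
    ((hasFDerivAt_const u x).inner ℝ h3)
    (fun y hy hyU => hp.inner_projD hy hyU b u v) ha
  simpa using h

/-- The derivative of the symmetry of the second fundamental form. -/
theorem fderiv_projD_symm (hp : IsProjExtension M U p) (hxM : x ∈ M) (hxU : x ∈ U) {a : Euc N}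
    (ha : a ∈ tangentSpace M x) (b c : Euc N) :
    fderiv ℝ (projD p) x a b (p x c) + projD p x b (projD p x a c)
      = fderiv ℝ (projD p) x a c (p x b) + projD p x c (projD p x a b) := by
  have h0 := hp.hasFDerivAt hxU
  have h1 := fun b => (hp.hasFDerivAt_projD hxU).clm_apply (hasFDerivAt_const b x)
  have h2 := fun c => h0.clm_apply (hasFDerivAt_const c x)
  have h := fderiv_eq_of_eqOn hp.isOpen hxM hxU ((h1 b).clm_apply (h2 c))
    ((h1 c).clm_apply (h2 b)) (fun y hy hyU => hp.projD_symm hy hyU b c) ha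
  simp only [ContinuousLinearMap.comp_zero, add_apply, zero_add,
    ContinuousLinearMap.comp_apply, ContinuousLinearMap.flip_apply] at h
  rw [hp.projD_of_mem hxM hxU ha, add_comm, h, add_comm]

/-- The second derivative of P² = P; the two mixed terms later account for the doubled normal part
of K(n). -/
theorem fderiv_projD_add (hp : IsProjExtension M U p) (hxM : x ∈ M) (hxU : x ∈ U) {a : Euc N}
    (ha : a ∈ tangentSpace M x) (b v : Euc N) :
    fderiv ℝ (projD p) x a b (p x v) + projD p x b (projD p x a v)
      + projD p x a (projD p x b v) + p x (fderiv ℝ (projD p) x a b v)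
      = fderiv ℝ (projD p) x a b v := by
  have h0 := hp.hasFDerivAt hxU
  have h1 := (hp.hasFDerivAt_projD hxU).clm_apply (hasFDerivAt_const b x)
  have h2 := h0.clm_apply (hasFDerivAt_const v x)
  have h3 := h1.clm_apply (hasFDerivAt_const v x)
  have h := fderiv_eq_of_eqOn hp.isOpen hxM hxU ((h1.clm_apply h2).add (h0.clm_apply h3))
    h3 (fun y hy hyU => hp.projD_add hy hyU b v) ha
  simp only [ContinuousLinearMap.comp_zero, add_apply, zero_add,
    ContinuousLinearMap.comp_apply, ContinuousLinearMap.flip_apply] at h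
  rw [hp.projD_of_mem hxM hxU ha]
  refine Eq.trans ?_ h
  abel

/-! ### The geometric quantities in terms of `projD` -/

theorem projDeriv_eq (hp : IsProjExtension M U p) (hxM : x ∈ M) (hxU : x ∈ U) {a : Euc N}
    (ha : a ∈ tangentSpace M x) (b : Euc N) : projDeriv M x a b = projD p x a b := by
  rw [projDeriv, dirDeriv_congr hp.isOpen hxM hxU (G := p)
    (fun y hy hyU => (hp.eq_proj y hy hyU).symm), dirDeriv_eq
    (hp.hasFDerivAt hxU).hasFDerivWithinAt ha, hp.projD_of_mem hxM hxU ha]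

theorem secondFundamentalForm_eq (hp : IsProjExtension M U p) (hxM : x ∈ M) (hxU : x ∈ U)
    {a b : Euc N} (ha : a ∈ tangentSpace M x) (hb : b ∈ tangentSpace M x) :
    secondFundamentalForm M x a b = projD p x a b := by
  have h : dirDeriv M (fun y => proj M y b) x a = projD p x a b := by
    rw [dirDeriv_congr hp.isOpen hxM hxU (G := fun y => p y b)
      (fun y hy hyU => by rw [hp.eq_proj y hy hyU]), dirDeriv_eq
      ((hp.hasFDerivAt hxU).clm_apply (hasFDerivAt_const b x)).hasFDerivWithinAt ha,
      hp.projD_of_mem hxM hxU ha]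
    simp
  have h0 := hp.apply_projD_apply hxM hxU a b
  rw [hp.apply_of_mem hxM hxU hb] at h0
  simp only [secondFundamentalForm, h]
  rw [← hp.eq_proj x hxM hxU, h0, sub_zero]

theorem inner_projD_of_mem (hp : IsProjExtension M U p) (hxM : x ∈ M) (hxU : x ∈ U)
    {a b c : Euc N} (hb : b ∈ tangentSpace M x) (hc : c ∈ tangentSpace M x) :
    inner ℝ c (projD p x a b) = (0 : ℝ) := by
  have h0 := hp.apply_projD_apply hxM hxU a b
  rw [hp.apply_of_mem hxM hxU hb] at h0
  rw [← hp.apply_of_mem hxM hxU hc, hp.inner_apply_left hxM hxU, h0, inner_zero_right]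

theorem projD_comm_of_mem (hp : IsProjExtension M U p) (hxM : x ∈ M) (hxU : x ∈ U)
    {a b : Euc N} (ha : a ∈ tangentSpace M x) (hb : b ∈ tangentSpace M x) :
    projD p x a b = projD p x b a := by
  have h := hp.projD_symm hxM hxU a b
  rwa [hp.apply_of_mem hxM hxU ha, hp.apply_of_mem hxM hxU hb] at h

theorem shape_eq (hp : IsProjExtension M U p) (hxM : x ∈ M) (hxU : x ∈ U)
    {a : Euc N} (ha : a ∈ tangentSpace M x) :
    shape M x a = frameSum M x fun τ => vec τ * vec (projD p x a τ) :=
  frameSum_congr fun τ hτ => by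
    rw [hp.projDeriv_eq hxM hxU hτ, hp.projD_comm_of_mem hxM hxU hτ ha]

/-- B(a,τ) is orthogonal to τ, so the wedge is a geometric product and the shape bivector has the
same expression as the shape. -/
theorem shapeBivector_eq (hp : IsProjExtension M U p) (hxM : x ∈ M) (hxU : x ∈ U)
    {a : Euc N} (ha : a ∈ tangentSpace M x) :
    shapeBivector M x a = frameSum M x fun τ => vec τ * vec (projD p x a τ) :=
  frameSum_congr fun τ hτ => by
    rw [hp.projDeriv_eq hxM hxU hτ, hp.projD_comm_of_mem hxM hxU hτ ha,
      wedge_vec_vec (hp.inner_projD_of_mem hxM hxU hτ hτ)]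

theorem shapeBivector_eq_sum (hp : IsProjExtension M U p) (hxM : x ∈ M) (hxU : x ∈ U)
    (a : Euc N) : shapeBivector M x (p x a) =
      ∑ i, wedgeVecL N (p x (stdBasis N i)) (projD p x a (stdBasis N i)) := by
  rw [hp.eq_proj x hxM hxU, ← frameSum_eq_sum_stdBasis M x
    (fun u v => wedgeVecL N u (projD p x a v)) (fun v => ⟨by simp, by simp⟩)
    (fun u => ⟨by simp, by simp⟩), ← hp.eq_proj x hxM hxU]
  refine frameSum_congr fun τ hτ => ?_
  rw [hp.projDeriv_eq hxM hxU hτ, hp.projD_comm_of_mem hxM hxU hτ (hp.apply_mem hxM hxU a),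
    hp.projD_apply_left hxM hxU]
  rfl

theorem meanCurvatureVector_eq_sum (hp : IsProjExtension M U p) (hxM : x ∈ M) (hxU : x ∈ U) :
    meanCurvatureVector M x =
      ∑ i, projD p x (stdBasis N i) (p x (stdBasis N i)) := by
  rw [hp.eq_proj x hxM hxU, ← frameSum_eq_sum_stdBasis M x
    (fun u v => projD p x v u) (fun v => ⟨by simp, by simp⟩)
    (fun u => ⟨by simp, by simp⟩)]
  exact frameSum_congr fun τ hτ => hp.secondFundamentalForm_eq hxM hxU hτ hτ

end IsProjExtension

/-! ### The curl of the mean curvature vector. -/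

/-- A symmetric operator on the tangent space has no curl. -/
theorem frameSum_wedge_eq_zero {M : Set (Euc N)} {x : Euc N} {L : Euc N → Euc N}
    (h1 : ∀ u ∈ tangentSpace M x, L u ∈ tangentSpace M x)
    (h2 : ∀ u ∈ tangentSpace M x, ∀ v ∈ tangentSpace M x,
      inner ℝ (L u) v = (inner ℝ u (L v) : ℝ)) :
    frameSum M x (fun τ => wedgeVecL N τ (L τ)) = 0 := by
  set b := frame M x
  have e : ∀ j, L (b j : Euc N) = ∑ k, (inner ℝ (b k : Euc N) (L (b j)) : ℝ) • (b k : Euc N) :=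
    fun j => by rw [← proj_eq_sum b, proj_of_mem (h1 _ (b j).2)]
  have h : frameSum M x (fun τ => wedgeVecL N τ (L τ))
      = -frameSum M x (fun τ => wedgeVecL N τ (L τ)) := by
    have e1 : frameSum M x (fun τ => wedgeVecL N τ (L τ)) = ∑ j, ∑ k,
        (inner ℝ (b k : Euc N) (L (b j)) : ℝ) • wedgeVecL N (b j : Euc N) (b k : Euc N) := by
      refine Finset.sum_congr rfl fun j _ => ?_
      change wedgeVecL N (b j : Euc N) (L (b j)) = _
      conv_lhs => rw [e j, map_sum]
      simp only [map_smul]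
    rw [e1]
    conv_lhs => rw [Finset.sum_comm]
    simp only [← Finset.sum_neg_distrib]
    refine Finset.sum_congr rfl fun l _ => Finset.sum_congr rfl fun k _ => ?_
    rw [← h2 _ (b l).2 _ (b k).2, real_inner_comm, wedgeVecL_apply, wedge_vec_swap, smul_neg]
    rfl
  have h3 : (2 : ℝ) • frameSum M x (fun τ => wedgeVecL N τ (L τ)) = 0 := by
    rw [two_smul]; nth_rewrite 1 [h]; exact neg_add_cancel _
  exact (smul_eq_zero.1 h3).resolve_left two_ne_zero

namespace IsProjExtension

variable {M U : Set (Euc N)} {p : Euc N → Euc N →L[ℝ] Euc N} {x : Euc N}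

theorem hasFDerivWithinAt_meanCurvatureVector (hp : IsProjExtension M U p) (hxM : x ∈ M)
    (hxU : x ∈ U) : ∃ H' : Euc N →L[ℝ] Euc N,
      HasFDerivWithinAt (meanCurvatureVector M) H' M x ∧ ∀ a ∈ tangentSpace M x,
        H' a = ∑ i, (fderiv ℝ (projD p) x a (stdBasis N i) (p x (stdBasis N i))
          + projD p x (stdBasis N i) (projD p x a (stdBasis N i))) := by
  have h0 := hp.hasFDerivAt hxU
  have h1 := fun b => (hp.hasFDerivAt_projD hxU).clm_apply (hasFDerivAt_const b x)
  have h2 := fun c => h0.clm_apply (hasFDerivAt_const c x)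
  have h := HasFDerivAt.fun_sum (u := Finset.univ) fun i _ =>
    (h1 (stdBasis N i)).clm_apply (h2 (stdBasis N i))
  refine ⟨_, hasFDerivWithinAt_congr hp.isOpen hxM hxU
    (fun y hy hyU => hp.meanCurvatureVector_eq_sum hy hyU) h.hasFDerivWithinAt, fun a ha => ?_⟩
  simp only [hp.projD_of_mem hxM hxU ha, ContinuousLinearMap.comp_zero, add_apply, zero_add,
    ContinuousLinearMap.comp_apply, ContinuousLinearMap.flip_apply,
    sum_apply]
  exact Finset.sum_congr rfl fun i _ => add_comm _ _

/-- The trace of the second derivative of the tangential projections. -/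
def trace (M : Set (Euc N)) (p : Euc N → Euc N →L[ℝ] Euc N) (x : Euc N) : Euc N →L[ℝ] Euc N :=
  frameSum M x fun τ => fderiv ℝ (projD p) x τ τ

theorem trace_apply (v : Euc N) :
    trace M p x v = frameSum M x fun τ => fderiv ℝ (projD p) x τ τ v := by
  simp only [trace, frameSum, sum_apply]

theorem inner_trace (hp : IsProjExtension M U p) (hxM : x ∈ M) (hxU : x ∈ U) (u v : Euc N) :
    inner ℝ (trace M p x u) v = (inner ℝ u (trace M p x v) : ℝ) := by
  simp only [trace_apply, frameSum, sum_inner, inner_sum]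
  exact Finset.sum_congr rfl fun j _ => hp.inner_fderiv_projD hxM hxU (frame M x j).2 _ _ _

/-- The normal parts of `(a·∂)H` and of `trace M p x a` agree. -/
theorem dirDeriv_meanCurvatureVector_sub_mem (hp : IsProjExtension M U p) (hxM : x ∈ M)
    (hxU : x ∈ U) {a : Euc N} (ha : a ∈ tangentSpace M x) :
    trace M p x a - dirDeriv M (meanCurvatureVector M) x a ∈ tangentSpace M x := by
  obtain ⟨H', hH', hH⟩ := hp.hasFDerivWithinAt_meanCurvatureVector hxM hxU
  have e1 := frameSum_eq_sum_stdBasis M x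
    (fun u v => fderiv ℝ (projD p) x a v u) (fun v => ⟨by simp, by simp⟩)
    (fun u => ⟨by simp, by simp⟩)
  have e2 := frameSum_eq_sum_stdBasis M x
    (fun u v => projD p x u (projD p x a v)) (fun v => ⟨by simp, by simp⟩)
    (fun u => ⟨by simp, by simp⟩)
  simp only [← hp.eq_proj x hxM hxU, hp.projD_apply_left hxM hxU] at e1 e2
  rw [dirDeriv_eq hH' ha, hH a ha, Finset.sum_add_distrib, ← e1, ← e2, trace_apply, frameSum,
    frameSum, frameSum, ← Finset.sum_add_distrib, ← Finset.sum_sub_distrib]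
  refine Submodule.sum_mem _ fun j _ => ?_
  have hτ := (frame M x j).2
  generalize ((frame M x j : tangentSpace M x) : Euc N) = τ at hτ
  -- The differentiated symmetry of B exchanges the last two slots of (∇D)_{τ,τ} a, and Codazzi the
  -- first two; the errors are products of two operators D applied to tangent vectors, hence
  -- tangent.
  have e3 := hp.fderiv_projD_symm hxM hxU hτ a τ
  rw [hp.apply_of_mem hxM hxU hτ, hp.apply_of_mem hxM hxU ha,
    ← hp.fderiv_projD_comm hxM hxU ha hτ] at e3
  have key : ∀ b c d : Euc N, d ∈ tangentSpace M x →
      projD p x b (projD p x c d) ∈ tangentSpace M x := fun b c d hd => by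
    have := hp.apply_projD_projD hxM hxU b c d
    rw [hp.apply_of_mem hxM hxU hd] at this
    rw [← this]; exact hp.apply_mem hxM hxU _
  have e4 : fderiv ℝ (projD p) x τ τ a - (fderiv ℝ (projD p) x a τ τ
      + projD p x τ (projD p x a τ)) = projD p x a (projD p x τ τ)
        - projD p x τ (projD p x τ a) - projD p x τ (projD p x a τ) := by
    rw [eq_sub_of_add_eq e3]; abel
  rw [e4]
  exact Submodule.sub_mem _ (Submodule.sub_mem _ (key _ _ _ hτ) (key _ _ _ ha)) (key _ _ _ hτ)

theorem apply_meanCurvatureVector (hp : IsProjExtension M U p) (hxM : x ∈ M) (hxU : x ∈ U) :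
    p x (meanCurvatureVector M x) = 0 := by
  rw [hp.meanCurvatureVector_eq_sum hxM hxU, map_sum]
  exact Finset.sum_eq_zero fun i _ => hp.apply_projD_apply hxM hxU _ _

theorem apply_dirDeriv_meanCurvatureVector (hp : IsProjExtension M U p) (hxM : x ∈ M)
    (hxU : x ∈ U) {a : Euc N} (ha : a ∈ tangentSpace M x) :
    p x (dirDeriv M (meanCurvatureVector M) x a) = -projD p x a (meanCurvatureVector M x) := by
  obtain ⟨H', hH', -⟩ := hp.hasFDerivWithinAt_meanCurvatureVector hxM hxU
  have h := dirDeriv_eq ((hp.hasFDerivAt hxU).hasFDerivWithinAt.clm_apply hH') ha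
  rw [dirDeriv_congr hp.isOpen hxM hxU (G := fun _ => (0 : Euc N))
    (fun y hy hyU => hp.apply_meanCurvatureVector hy hyU),
    dirDeriv_eq (hasFDerivWithinAt_const 0 x M) ha] at h
  rw [dirDeriv_eq hH' ha, hp.projD_of_mem hxM hxU ha, eq_neg_iff_add_eq_zero]
  exact h.symm

/-- Since H is normal, ⟨(a·∂)H, b⟩ = -⟨H, B(a,b)⟩, which is symmetric in a and b. -/
theorem inner_dirDeriv_meanCurvatureVector (hp : IsProjExtension M U p) (hxM : x ∈ M)
    (hxU : x ∈ U) {a b : Euc N} (ha : a ∈ tangentSpace M x) (hb : b ∈ tangentSpace M x) :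
    inner ℝ (dirDeriv M (meanCurvatureVector M) x a) b
      = (inner ℝ a (dirDeriv M (meanCurvatureVector M) x b) : ℝ) := by
  have h : ∀ a ∈ tangentSpace M x, ∀ b ∈ tangentSpace M x,
      inner ℝ (dirDeriv M (meanCurvatureVector M) x a) b
        = -(inner ℝ (meanCurvatureVector M x) (projD p x a b) : ℝ) := fun a ha b hb => by
    rw [← hp.apply_of_mem hxM hxU hb, ← hp.inner_apply_left hxM hxU,
      hp.apply_dirDeriv_meanCurvatureVector hxM hxU ha, inner_neg_left,
      hp.inner_projD hxM hxU, hp.apply_of_mem hxM hxU hb]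
  rw [h a ha b hb, real_inner_comm _ a, h b hb a ha, hp.projD_comm_of_mem hxM hxU ha hb]

theorem dirDeriv_vec {F : Euc N → Euc N} {F' : Euc N →L[ℝ] Euc N}
    (hF : HasFDerivWithinAt F F' M x) {a : Euc N} (ha : a ∈ tangentSpace M x) :
    dirDeriv M (fun y => vec (F y)) x a = vec (dirDeriv M F x a) := by
  rw [dirDeriv_eq hF ha]
  exact dirDeriv_eq (((CliffordAlgebra.ι (sqForm N)).toContinuousLinearMap.hasFDerivAt
    (x := F x)).comp_hasFDerivWithinAt x hF) ha

theorem curl_eq_frameSum (hp : IsProjExtension M U p) (hxM : x ∈ M) (hxU : x ∈ U) :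
    curl M (fun y => vec (meanCurvatureVector M y)) x
      = frameSum M x fun τ => wedgeVecL N τ (dirDeriv M (meanCurvatureVector M) x τ) := by
  obtain ⟨H', hH', -⟩ := hp.hasFDerivWithinAt_meanCurvatureVector hxM hxU
  exact frameSum_congr fun τ hτ => by rw [dirDeriv_vec hH' hτ]; rfl

/-- The difference of the two operators is tangential and symmetric, so it does not contribute to
the curl. -/
theorem curl_eq_trace (hp : IsProjExtension M U p) (hxM : x ∈ M) (hxU : x ∈ U) :
    curl M (fun y => vec (meanCurvatureVector M y)) x
      = frameSum M x fun τ => wedgeVecL N τ (trace M p x τ) := by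
  have h := frameSum_wedge_eq_zero (M := M) (x := x)
    (L := fun a => trace M p x a - dirDeriv M (meanCurvatureVector M) x a)
    (fun a ha => hp.dirDeriv_meanCurvatureVector_sub_mem hxM hxU ha)
    (fun a ha b hb => by
      rw [inner_sub_left, inner_sub_right, hp.inner_trace hxM hxU,
        hp.inner_dirDeriv_meanCurvatureVector hxM hxU ha hb])
  rw [hp.curl_eq_frameSum hxM hxU]
  simp only [map_sub, frameSum, Finset.sum_sub_distrib] at h
  exact (sub_eq_zero.1 h).symm

/-- The tangential part of the derivative of H is symmetric and drops out. What remains pairs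
tangent with normal vectors, the form required by the commutation rules with the Gauss map. -/
theorem curl_eq_normal (hp : IsProjExtension M U p) (hxM : x ∈ M) (hxU : x ∈ U) :
    curl M (fun y => vec (meanCurvatureVector M y)) x
      = frameSum M x fun τ => vec τ * vec (dirDeriv M (meanCurvatureVector M) x τ
        - p x (dirDeriv M (meanCurvatureVector M) x τ)) := by
  have h := frameSum_wedge_eq_zero (M := M) (x := x)
    (L := fun a => p x (dirDeriv M (meanCurvatureVector M) x a))
    (fun a ha => hp.apply_mem hxM hxU _)
    (fun a ha b hb => by
      rw [hp.inner_apply_left hxM hxU, hp.apply_of_mem hxM hxU hb,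
        ← hp.inner_apply_left hxM hxU a, hp.apply_of_mem hxM hxU ha,
        hp.inner_dirDeriv_meanCurvatureVector hxM hxU ha hb])
  rw [hp.curl_eq_frameSum hxM hxU, ← sub_zero (frameSum M x _), ← h, frameSum, frameSum,
    ← Finset.sum_sub_distrib]
  refine frameSum_congr (f := fun τ => wedgeVecL N τ (dirDeriv M (meanCurvatureVector M) x τ)
    - wedgeVecL N τ (p x (dirDeriv M (meanCurvatureVector M) x τ))) fun τ hτ => ?_
  rw [← map_sub, wedgeVecL_apply, wedge_vec_vec]
  rw [← hp.apply_of_mem hxM hxU hτ, hp.inner_apply_left hxM hxU, map_sub,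
    hp.apply_apply hxM hxU, sub_self, inner_zero_right]

/-! ### From the first-order equation to the Laplacian. -/

/-- The Laplacian of a field `T` with `(a·∂)T = T S_a`. -/
theorem laplaceBeltrami_eq (hp : IsProjExtension M U p) (hxM : x ∈ M) (hxU : x ∈ U)
    {T : Euc N → GA N} {T' : Euc N →L[ℝ] GA N} (hT : HasFDerivWithinAt T T' M x)
    (h : ∀ y ∈ M, ∀ a ∈ tangentSpace M y, dirDeriv M T y a = T y * shapeBivector M y a) :
    laplaceBeltrami M T x
      = T x * frameSum M x (fun τ => shapeBivector M x τ * shapeBivector M x τ)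
        + T x * curl M (fun y => vec (meanCurvatureVector M y)) x := by
  have h0 := hp.hasFDerivAt hxU
  have key : ∀ τ ∈ tangentSpace M x,
      dirDeriv M (fun y => dirDeriv M T y (proj M y τ)) x τ
        = T x * (shapeBivector M x τ * shapeBivector M x τ)
          + T x * frameSum M x (fun σ => wedgeVecL N σ (fderiv ℝ (projD p) x τ τ σ)) := by
    intro τ hτ
    have h1 := (hp.hasFDerivAt_projD hxU).clm_apply (hasFDerivAt_const τ x)
    have h2 := fun c => h0.clm_apply (hasFDerivAt_const c x)
    have h3 := fun c => h1.clm_apply (hasFDerivAt_const c x)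
    have h4 := HasFDerivAt.fun_sum (u := Finset.univ) fun i _ =>
      (wedgeVecL N).hasFDerivAt_of_bilinear (h2 (stdBasis N i)) (h3 (stdBasis N i))
    have h5 := (mulL N).hasFDerivWithinAt_of_bilinear hT h4.hasFDerivWithinAt
    have e1 := frameSum_eq_sum_stdBasis M x
      (fun u v => wedgeVecL N u (fderiv ℝ (projD p) x τ τ v)) (fun v => ⟨by simp, by simp⟩)
      (fun u => ⟨by simp, by simp⟩)
    rw [dirDeriv_congr hp.isOpen hxM hxU (G := fun y => mulL N (T y)
        (∑ i, wedgeVecL N (p y (stdBasis N i)) (projD p y τ (stdBasis N i))))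
        (fun y hy hyU => by
          rw [h y hy _ (proj_mem M y τ), ← hp.eq_proj y hy hyU,
            hp.shapeBivector_eq_sum hy hyU, mulL_apply]),
      dirDeriv_eq h5 hτ, ← hp.shapeBivector_eq_sum hxM hxU, hp.apply_of_mem hxM hxU hτ, e1,
      ← hp.eq_proj x hxM hxU]
    have e2 : T' τ = T x * shapeBivector M x τ := by
      rw [← h x hxM τ hτ, dirDeriv_eq hT hτ]
    -- Differentiating the first factor of each wedge gives D_τ e_i ∧ D_τ e_i = 0, so only the
    -- derivatives of T and of the second factor remain.
    simp only [add_apply, ContinuousLinearMap.precompR_apply, ContinuousLinearMap.compL_apply,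
      ContinuousLinearMap.precompL_apply,
      sum_apply, ContinuousLinearMap.comp_zero, zero_add,
      ContinuousLinearMap.flip_apply, ContinuousLinearMap.comp_apply, e2, mulL_apply,
      hp.projD_of_mem hxM hxU hτ, wedgeVecL_apply, wedge_vec_self, add_zero]
    rw [add_comm, mul_assoc]
  rw [laplaceBeltrami, frameSum_congr key, frameSum, frameSum, Finset.sum_add_distrib,
    ← Finset.mul_sum, ← Finset.mul_sum, hp.curl_eq_trace hxM hxU]
  congr 2
  simp only [trace_apply, frameSum, map_sum]
  exact Finset.sum_comm

end IsProjExtension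

/-! ### Differentiability of the Gauss map. -/

theorem toExt_wedge (A B : GA N) : toExt N (wedge A B) = toExt N A * toExt N B := by
  rw [wedge, LinearEquiv.apply_symm_apply]

theorem continuous_blade (N m : ℕ) : Continuous (blade : (Fin m → Euc N) → GA N) := by
  induction m with
  | zero => simp only [funext blade_zero]; exact continuous_const
  | succ m ih =>
    have h : (blade : (Fin (m + 1) → Euc N) → GA N) = fun a =>
        (wedgeₗ N).toContinuousBilinearMap
          ((CliffordAlgebra.ι (sqForm N)).toContinuousLinearMap (a 0))
          (blade fun j : Fin m => a j.succ) := by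
      ext1 a
      apply (toExt N).injective
      refine Eq.trans ?_ (toExt_wedge (vec (a 0)) (blade fun j : Fin m => a j.succ)).symm
      rw [toExt_vec, blade, blade, LinearEquiv.apply_symm_apply, LinearEquiv.apply_symm_apply,
        ExteriorAlgebra.ιMulti_succ_apply]
      rfl
    rw [h]
    exact ((ContinuousLinearMap.continuous _).comp
      ((ContinuousLinearMap.continuous _).comp (continuous_apply 0))).clm_apply
      (ih.comp (continuous_pi fun j => continuous_apply _))

/-- Blades as a continuous multilinear map. -/
def bladeL (N m : ℕ) : ContinuousMultilinearMap ℝ (fun _ : Fin m => Euc N) (GA N) :=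
  ⟨(toExt N).symm.toLinearMap.compMultilinearMap
    (ExteriorAlgebra.ιMulti ℝ m : Euc N [⋀^Fin m]→ₗ[ℝ] _).toMultilinearMap, continuous_blade N m⟩

theorem bladeL_apply {m : ℕ} (a : Fin m → Euc N) : bladeL N m a = blade a := rfl

/-- Blades of `m` vectors of an `m`-dimensional space are proportional. -/
theorem blade_eq_det_smul {m : ℕ} {K : Submodule ℝ (Euc N)} (b : Module.Basis (Fin m) ℝ K)
    (v : Fin m → K) :
    blade (fun j => (v j : Euc N)) = b.det v • blade fun j => (b j : Euc N) := by
  set f : K [⋀^Fin m]→ₗ[ℝ] GA N := (toExt N).symm.toLinearMap.compAlternatingMap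
    ((ExteriorAlgebra.ιMulti ℝ m).compLinearMap K.subtype)
  change f v = b.det v • f b
  -- Linear functionals reduce the claim to scalar-valued alternating forms of top degree, which are
  -- multiples of the determinant.
  rw [← sub_eq_zero, ← Module.forall_dual_apply_eq_zero_iff ℝ]
  intro φ
  have h := congrArg (fun g : K [⋀^Fin m]→ₗ[ℝ] ℝ => g v)
    (AlternatingMap.eq_smul_basis_det b (φ.compAlternatingMap f))
  simp only [LinearMap.compAlternatingMap_apply, AlternatingMap.smul_apply, smul_eq_mul] at h
  rw [map_sub, map_smul, h, smul_eq_mul, mul_comm, sub_self]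

/-- The scalar part of a multivector. -/
def scalarPart (N : ℕ) : GA N →L[ℝ] ℝ :=
  ((ExteriorAlgebra.algebraMapInv (R := ℝ) (M := Euc N)).toLinearMap ∘ₗ
    (toExt N).toLinearMap).toContinuousLinearMap

theorem scalarPart_algebraMap (r : ℝ) : scalarPart N (algebraMap ℝ _ r) = r := by
  change ExteriorAlgebra.algebraMapInv (toExt N (algebraMap ℝ _ r)) = r
  rw [toExt_algebraMap]
  exact ExteriorAlgebra.algebraMap_leftInverse (Euc N) r

theorem frameSum_vec_mul_vec {ι : Type*} [Fintype ι] {M : Set (Euc N)} {x : Euc N}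
    (b : OrthonormalBasis ι ℝ (tangentSpace M x)) {L : Euc N → Euc N} (hL : IsLinearMap ℝ L)
    (h : ∀ u ∈ tangentSpace M x, ∀ v ∈ tangentSpace M x, inner ℝ u (L v) = (0 : ℝ)) :
    frameSum M x (fun τ => vec τ * vec (L τ)) = ∑ j, vec (b j : Euc N) * vec (L (b j)) := by
  have e := frameSum_eq_sum b (fun u v => wedgeVecL N u (L v)) (fun v => ⟨by simp, by simp⟩)
    (fun u => ⟨fun v w => by rw [hL.map_add, map_add], fun c v => by rw [hL.map_smul, map_smul]⟩)
  refine Eq.trans (frameSum_congr fun τ hτ => (wedge_vec_vec (h τ hτ τ hτ)).symm) (e.trans ?_)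
  exact Finset.sum_congr rfl fun j _ => wedge_vec_vec (h _ (b j).2 _ (b j).2)

/-- For L = D_a the right side is the Leibniz derivative of the blade. It also shows that the
product has grade m. -/
theorem blade_mul_sum {m : ℕ} {M : Set (Euc N)} {x : Euc N}
    (b : OrthonormalBasis (Fin m) ℝ (tangentSpace M x)) {L : Euc N → Euc N}
    (hL : IsLinearMap ℝ L)
    (h : ∀ u ∈ tangentSpace M x, ∀ v ∈ tangentSpace M x, inner ℝ u (L v) = (0 : ℝ)) :
    blade (fun j => (b j : Euc N)) * frameSum M x (fun τ => vec τ * vec (L τ))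
      = ∑ j, blade (Function.update (fun j => (b j : Euc N)) j (L (b j))) := by
  rw [frameSum_vec_mul_vec b hL h, Finset.mul_sum]
  refine Finset.sum_congr rfl fun j _ => blade_mul_vec_mul_vec (orthonormal_coe b) (fun k => ?_) j
  rw [real_inner_comm]; exact h _ (b k).2 _ (b j).2

theorem blade_mul_sum_comm {m : ℕ} {M : Set (Euc N)} {x : Euc N}
    (b : OrthonormalBasis (Fin m) ℝ (tangentSpace M x)) {L : Euc N → Euc N}
    (hL : IsLinearMap ℝ L)
    (h : ∀ u ∈ tangentSpace M x, ∀ v ∈ tangentSpace M x, inner ℝ u (L v) = (0 : ℝ)) :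
    blade (fun j => (b j : Euc N)) * frameSum M x (fun τ => vec τ * vec (L τ))
      = -(frameSum M x (fun τ => vec τ * vec (L τ)) * blade fun j => (b j : Euc N)) := by
  rw [frameSum_vec_mul_vec b hL h, Finset.mul_sum, Finset.sum_mul, ← Finset.sum_neg_distrib]
  refine Finset.sum_congr rfl fun j _ => blade_mul_bivector (orthonormal_coe b) (fun k => ?_) j
  rw [real_inner_comm]; exact h _ (b k).2 _ (b j).2

/-- If `G = c • F` on `M`, where `c` is continuous with value `1` at `x`, and if `G` and `c ^ 2`
are differentiable, then so is `F`. -/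
theorem exists_hasFDerivWithinAt_of_eq_smul {V : Type*} [NormedAddCommGroup V] [NormedSpace ℝ V]
    {M U : Set (Euc N)} (hU : IsOpen U) {x : Euc N} (hxM : x ∈ M) (hxU : x ∈ U)
    {F G : Euc N → V} {c q : Euc N → ℝ} {G' : Euc N →L[ℝ] V} {q' : Euc N →L[ℝ] ℝ}
    (hG : HasFDerivAt G G' x) (hq : HasFDerivAt q q' x) (hc : ContinuousWithinAt c M x)
    (hcx : c x = 1) (hcG : ∀ y ∈ M, y ∈ U → G y = c y • F y)
    (hqc : ∀ y ∈ M, y ∈ U → q y = c y ^ 2) :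
    ∃ F' : Euc N →L[ℝ] V, HasFDerivWithinAt F F' M x ∧ ∀ a, q' a = 0 → F' a = G' a := by
  have hqx : q x = 1 := by rw [hqc x hxM hxU, hcx, one_pow]
  have hGx : G x = F x := by rw [hcG x hxM hxU, hcx, one_smul]
  -- Continuity is needed only to fix the sign: near x, c is positive, so c = √q and F = G/√q.
  have hcpos : ∀ᶠ y in nhdsWithin x M, 0 < c y :=
    hc.eventually (lt_mem_nhds (by rw [hcx]; exact one_pos))
  have hr : HasDerivAt (fun t : ℝ => (√t)⁻¹) (-(1 / (2 * √(q x))) / √(q x) ^ 2) (q x) :=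
    (Real.hasDerivAt_sqrt (by rw [hqx]; exact one_ne_zero)).fun_inv
      (by rw [hqx, Real.sqrt_one]; exact one_ne_zero)
  have hd := ((hr.comp_hasFDerivAt x hq).smul hG).hasFDerivWithinAt (s := M)
  refine ⟨_, hd.congr_of_eventuallyEq ?_ ?_, fun a ha => ?_⟩
  · filter_upwards [self_mem_nhdsWithin, nhdsWithin_le_nhds (hU.mem_nhds hxU), hcpos]
      with y hy hyU hpos
    change F y = (√(q y))⁻¹ • G y
    rw [hqc y hy hyU, Real.sqrt_sq hpos.le, hcG y hy hyU, inv_smul_smul₀ hpos.ne']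
  · change F x = (√(q x))⁻¹ • G x
    rw [hqx, hGx, Real.sqrt_one, inv_one, one_smul]
  · simp only [Function.comp_apply, add_apply, smul_apply,
      ContinuousLinearMap.smulRight_apply, ha]
    simp only [smul_zero, zero_smul, add_zero]
    rw [hqx, Real.sqrt_one, inv_one, one_smul]

namespace IsProjExtension

variable {M U : Set (Euc N)} {p : Euc N → Euc N →L[ℝ] Euc N} {x : Euc N}

/-- The Gauss map is differentiable, with `(a·∂)T = T S_a`. -/
theorem hasFDerivWithinAt_gaussMap {m : ℕ} (hp : IsProjExtension M U p) (hxM : x ∈ M)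
    (hxU : x ∈ U) {T : Euc N → GA N} (hT : IsGaussMap m M T) :
    ∃ T' : Euc N →L[ℝ] GA N, HasFDerivWithinAt T T' M x ∧
      ∀ a ∈ tangentSpace M x, T' a = T x * shapeBivector M x a := by
  obtain ⟨τ, hτ⟩ := hT.2 x hxM
  obtain ⟨ε, hε, hsq⟩ := exists_blade_mul_self N m
  have hTT : ∀ y ∈ M, T y * T y = algebraMap ℝ (GA N) ε := fun y hy => by
    obtain ⟨σ, hσ⟩ := hT.2 y hy
    rw [hσ]; exact hsq _ (orthonormal_coe σ)
  -- The frame at x is projected to the nearby tangent spaces. Its blade is differentiable at x and,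
  -- on M, a multiple of the Gauss map.
  set G : Euc N → GA N := fun y => bladeL N m fun j => p y (τ j : Euc N) with hG
  have hGT : ∀ y ∈ M, y ∈ U → ∃ c : ℝ, G y = c • T y := fun y hy hyU => by
    obtain ⟨σ, hσ⟩ := hT.2 y hy
    have h := blade_eq_det_smul σ.toBasis fun j => ⟨p y (τ j : Euc N), hp.apply_mem hy hyU _⟩
    rw [OrthonormalBasis.coe_toBasis] at h
    rw [hσ]
    exact ⟨_, h⟩
  have hGx : G x = T x := by
    rw [hG, hτ]
    simp only [bladeL_apply, hp.apply_of_mem hxM hxU (τ _).2]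
  -- the derivative of the unnormalized blade
  have hL : ∀ a, IsLinearMap ℝ (projD p x a) := fun a => ⟨by simp, by simp⟩
  have hN : ∀ a, ∀ u ∈ tangentSpace M x, ∀ v ∈ tangentSpace M x,
      inner ℝ u (projD p x a v) = (0 : ℝ) :=
    fun a u hu v hv => hp.inner_projD_of_mem hxM hxU hv hu
  have h1 : HasFDerivAt (fun y => fun j => p y (τ j : Euc N))
      (ContinuousLinearMap.pi fun j => (p x).comp 0 + (fderiv ℝ p x).flip (τ j : Euc N)) x :=
    hasFDerivAt_pi.2 fun j => (hp.hasFDerivAt hxU).clm_apply (hasFDerivAt_const _ x)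
  have hGd := ((bladeL N m).hasFDerivAt fun j => p x (τ j : Euc N)).comp x h1
  obtain ⟨G', hG', hG'a⟩ : ∃ G' : Euc N →L[ℝ] GA N, HasFDerivAt G G' x ∧
      ∀ a ∈ tangentSpace M x, G' a = T x * shapeBivector M x a := by
    refine ⟨_, hGd, fun a ha => ?_⟩
    rw [hp.shapeBivector_eq hxM hxU ha, hτ, blade_mul_sum τ (hL a) (hN a)]
    simp [hp.projD_of_mem hxM hxU ha, hp.apply_of_mem hxM hxU (τ _).2, bladeL_apply]
  -- As T² = ε and ε² = 1, c reads off the factor in G = cT, and q equals c² on M while being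
  -- differentiable at x.
  set c : Euc N → ℝ := fun y => scalarPart N (ε • mulL N (G y) (T y)) with hc
  set q : Euc N → ℝ := fun y => scalarPart N (ε • mulL N (G y) (G y)) with hq
  have hcG : ∀ y ∈ M, y ∈ U → G y = c y • T y := fun y hy hyU => by
    obtain ⟨r, hr⟩ := hGT y hy hyU
    have : c y = r := by
      simp only [hc]
      rw [hr, mulL_apply, smul_mul_assoc, hTT y hy, map_smul, map_smul, scalarPart_algebraMap,
        smul_eq_mul, smul_eq_mul, mul_left_comm, hε, mul_one]
    rw [this, hr]
  have hqc : ∀ y ∈ M, y ∈ U → q y = c y ^ 2 := fun y hy hyU => by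
    have h := hcG y hy hyU
    simp only [hq]
    rw [h, mulL_apply, smul_mul_smul_comm, hTT y hy, map_smul, map_smul,
      scalarPart_algebraMap, smul_eq_mul, smul_eq_mul, mul_left_comm, hε, mul_one, sq]
  have hcx : c x = 1 := by
    simp only [hc]
    rw [hGx, mulL_apply, hTT x hxM, map_smul, scalarPart_algebraMap, smul_eq_mul, hε]
  have hcc : ContinuousWithinAt c M x := by
    have h2 : ContinuousWithinAt (fun y => mulL N (G y) (T y)) M x :=
      ((mulL N).continuous.continuousAt.comp_continuousWithinAt
        hG'.continuousAt.continuousWithinAt).clm_apply (hT.1 x hxM)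
    exact (scalarPart N).continuous.continuousAt.comp_continuousWithinAt (h2.const_smul ε)
  have hqd := (scalarPart N).hasFDerivAt.comp x
    (((mulL N).hasFDerivAt_of_bilinear hG' hG').const_smul ε)
  obtain ⟨T', hT', hT'a⟩ := exists_hasFDerivWithinAt_of_eq_smul hp.isOpen hxM hxU hG' hqd hcc hcx
    hcG hqc
  refine ⟨T', hT', fun a ha => ?_⟩
  -- T anticommutes with S_a, so G² is stationary at x in tangent directions and the normalization
  -- does not affect the derivative.
  have h0 : T x * (T x * shapeBivector M x a) + T x * shapeBivector M x a * T x = 0 := by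
    have h := blade_mul_sum_comm τ (hL a) (hN a)
    rw [← hτ, ← hp.shapeBivector_eq hxM hxU ha] at h
    rw [mul_assoc, ← mul_add, h, neg_add_cancel, mul_zero]
  have h3 : ((mulL N).precompR (Euc N) (G x) G' + (mulL N).precompL (Euc N) G' (G x)) a = 0 := by
    simp only [add_apply, ContinuousLinearMap.precompR_apply, ContinuousLinearMap.compL_apply,
      ContinuousLinearMap.comp_apply, ContinuousLinearMap.precompL_apply, mulL_apply, hGx,
      hG'a a ha]
    exact h0
  rw [hT'a a, hG'a a ha]
  rw [ContinuousLinearMap.comp_apply, smul_apply, h3, smul_zero, map_zero]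

end IsProjExtension

/-! ### Grades and the equation for the Gauss map. -/

/-- The grade of a multivector field is preserved by directional derivatives. -/
theorem gradePart_dirDeriv {m : ℕ} {M : Set (Euc N)} {F : Euc N → GA N}
    (hF : ∀ y ∈ M, gradePart m (F y) = F y) {x : Euc N} (hx : x ∈ M) {a : Euc N}
    (ha : a ∈ tangentSpace M x) : gradePart m (dirDeriv M F x a) = dirDeriv M F x a := by
  by_cases h : DifferentiableWithinAt ℝ F M x
  · have h1 := (gradePartₗ N m).toContinuousLinearMap.hasFDerivAt.comp_hasFDerivWithinAt x
      h.hasFDerivWithinAt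
    have h2 := dirDeriv_eq h1 ha
    exact h2.symm.trans (dirDeriv_congr isOpen_univ hx trivial (fun y hy _ => hF y hy) a)
  · rw [dirDeriv, fderivWithin_zero_of_not_differentiableWithinAt h]
    exact map_zero (gradePartₗ N m)

theorem IsGaussMap.gradePart_eq {m : ℕ} {M : Set (Euc N)} {T : Euc N → GA N}
    (hT : IsGaussMap m M T) {x : Euc N} (hx : x ∈ M) : gradePart m (T x) = T x := by
  obtain ⟨τ, hτ⟩ := hT.2 x hx
  rw [hτ, gradePart_blade]

theorem IsGaussMap.gradePart_laplaceBeltrami {m : ℕ} {M : Set (Euc N)} {T : Euc N → GA N}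
    (hT : IsGaussMap m M T) {x : Euc N} (hx : x ∈ M) :
    gradePart m (laplaceBeltrami M T x) = laplaceBeltrami M T x := by
  rw [laplaceBeltrami, frameSum, ← gradePartₗ_apply, map_sum]
  refine Finset.sum_congr rfl fun j _ => gradePart_dirDeriv (fun y hy => ?_) hx (frame M x j).2
  exact gradePart_dirDeriv (fun z hz => hT.gradePart_eq hz) hy (proj_mem M y _)

namespace IsProjExtension

variable {M U : Set (Euc N)} {p : Euc N → Euc N →L[ℝ] Euc N} {x : Euc N}

theorem normSqB_eq (hp : IsProjExtension M U p) (hxM : x ∈ M) (hxU : x ∈ U) :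
    normSqB M x = frameSum M x fun τ => ∑ l, ‖projD p x τ (frame M x l : Euc N)‖ ^ 2 :=
  frameSum_congr fun τ hτ => frameSum_congr (g := fun σ => ‖projD p x τ σ‖ ^ 2) fun σ hσ => by
    rw [hp.secondFundamentalForm_eq hxM hxU hτ hσ]

theorem frameSum_shapeBivector_sq (hp : IsProjExtension M U p) (hxM : x ∈ M) (hxU : x ∈ U) :
    frameSum M x (fun τ => shapeBivector M x τ * shapeBivector M x τ)
      = shapeWedgeShape M x - normSqB M x • (1 : GA N) := by
  rw [hp.normSqB_eq hxM hxU, shapeWedgeShape, frameSum, frameSum, frameSum, Finset.sum_smul,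
    ← Finset.sum_sub_distrib]
  refine Finset.sum_congr rfl fun j _ => ?_
  rw [hp.shapeBivector_eq hxM hxU (frame M x j).2, hp.shape_eq hxM hxU (frame M x j).2]
  exact sum_bivector_mul_self (orthonormal_coe (frame M x)) fun l k =>
    hp.inner_projD_of_mem hxM hxU (frame M x k).2 (frame M x l).2

/-- Jacobi's field equation for the Gauss map. -/
theorem jacobi_gaussMap {m : ℕ} (hp : IsProjExtension M U p) (hxM : x ∈ M) (hxU : x ∈ U)
    {T : Euc N → GA N} (hT : IsGaussMap m M T) {T' : Euc N →L[ℝ] GA N}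
    (hT' : HasFDerivWithinAt T T' M x)
    (h : ∀ y ∈ M, ∀ a ∈ tangentSpace M y, dirDeriv M T y a = T y * shapeBivector M y a) :
    laplaceBeltrami M T x + normSqB M x • T x - gradePart m (shapeWedgeShape M x * T x)
        + curl M (fun y => vec (meanCurvatureVector M y)) x * T x = 0 := by
  obtain ⟨τ, hτ⟩ := hT.2 x hxM
  obtain ⟨H', hH', -⟩ := hp.hasFDerivWithinAt_meanCurvatureVector hxM hxU
  have hL : ∀ a, IsLinearMap ℝ (projD p x a) := fun a => ⟨by simp, by simp⟩
  have hN : ∀ a, ∀ u ∈ tangentSpace M x, ∀ v ∈ tangentSpace M x,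
      inner ℝ u (projD p x a v) = (0 : ℝ) :=
    fun a u hu v hv => hp.inner_projD_of_mem hxM hxU hv hu
  have hS : ∀ a ∈ tangentSpace M x, T x * shapeBivector M x a = -(shapeBivector M x a * T x) :=
    fun a ha => by
      rw [hp.shapeBivector_eq hxM hxU ha, hτ]; exact blade_mul_sum_comm τ (hL a) (hN a)
  -- Two anticommutations, so T commutes with each S_τ².
  have hSS : T x * frameSum M x (fun τ => shapeBivector M x τ * shapeBivector M x τ)
      = frameSum M x (fun τ => shapeBivector M x τ * shapeBivector M x τ) * T x := by
    rw [frameSum, Finset.mul_sum, Finset.sum_mul]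
    refine Finset.sum_congr rfl fun j _ => ?_
    have hj := hS _ (frame M x j).2
    rw [← mul_assoc, hj, neg_mul, mul_assoc, hj, mul_neg, neg_neg, mul_assoc]
  have hL2 : IsLinearMap ℝ fun a => dirDeriv M (meanCurvatureVector M) x a
      - p x (dirDeriv M (meanCurvatureVector M) x a) :=
    ⟨fun u v => by simp only [dirDeriv, map_add]; abel,
      fun c v => by simp only [dirDeriv, map_smul, smul_sub]⟩
  have hN2 : ∀ u ∈ tangentSpace M x, ∀ v ∈ tangentSpace M x,
      inner ℝ u (dirDeriv M (meanCurvatureVector M) x v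
        - p x (dirDeriv M (meanCurvatureVector M) x v)) = (0 : ℝ) := fun u hu v _ => by
    rw [← hp.apply_of_mem hxM hxU hu, hp.inner_apply_left hxM hxU, map_sub,
      hp.apply_apply hxM hxU, sub_self, inner_zero_right]
  have hC : T x * curl M (fun y => vec (meanCurvatureVector M y)) x
      = -(curl M (fun y => vec (meanCurvatureVector M y)) x * T x) := by
    rw [hp.curl_eq_normal hxM hxU, hτ]; exact blade_mul_sum_comm τ hL2 hN2
  have hCg : gradePart m (T x * curl M (fun y => vec (meanCurvatureVector M y)) x)
      = T x * curl M (fun y => vec (meanCurvatureVector M y)) x := by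
    rw [hp.curl_eq_normal hxM hxU, hτ, blade_mul_sum τ hL2 hN2, ← gradePartₗ_apply, map_sum]
    exact Finset.sum_congr rfl fun j _ => gradePart_blade _
  have hΔ := hp.laplaceBeltrami_eq hxM hxU hT' h
  rw [hSS, hp.frameSum_shapeBivector_sq hxM hxU, sub_mul, smul_mul_assoc, one_mul] at hΔ
  -- Every term on the right has grade m, so the grade projection leaves the product of the 4-vector
  -- with T unchanged.
  have e : shapeWedgeShape M x * T x = laplaceBeltrami M T x + normSqB M x • T x
      - T x * curl M (fun y => vec (meanCurvatureVector M y)) x := by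
    rw [hΔ]; abel
  rw [e, ← gradePartₗ_apply, map_sub, map_add, map_smul, gradePartₗ_apply, gradePartₗ_apply,
    gradePartₗ_apply, hT.gradePart_laplaceBeltrami hxM, hT.gradePart_eq hxM, hCg, hC]
  abel

end IsProjExtension

/-! ### Hypersurfaces. -/

/-- Normal vectors of a hypersurface are multiples of the unit normal. -/
theorem eq_inner_smul_of_mem_orthogonal {K : Submodule ℝ (Euc N)}
    (hK : Module.finrank ℝ K + 1 = N) {n v : Euc N} (hn : n ∈ Kᗮ) (h1 : ‖n‖ = 1) (hv : v ∈ Kᗮ) :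
    v = (inner ℝ n v : ℝ) • n := by
  have hd : Module.finrank ℝ Kᗮ = 1 := by
    have := K.finrank_add_finrank_orthogonal
    rw [finrank_euclideanSpace_fin] at this
    omega
  have hn0 : (⟨n, hn⟩ : Kᗮ) ≠ 0 := fun h => by
    have : n = 0 := congrArg Subtype.val h
    rw [this, norm_zero] at h1
    exact zero_ne_one h1
  obtain ⟨c, hc⟩ := (finrank_eq_one_iff_of_nonzero' _ hn0).1 hd ⟨v, hv⟩
  have hc' : c • n = v := congrArg Subtype.val hc
  rw [← hc', inner_smul_right, real_inner_self_eq_norm_sq, h1, one_pow, mul_one]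

theorem IsGaussMap.finrank_tangentSpace {m : ℕ} {M : Set (Euc N)} {T : Euc N → GA N}
    (hT : IsGaussMap m M T) {x : Euc N} (hx : x ∈ M) :
    Module.finrank ℝ (tangentSpace M x) = m := by
  obtain ⟨τ, -⟩ := hT.2 x hx
  rw [Module.finrank_eq_card_basis τ.toBasis, Fintype.card_fin]

namespace IsProjExtension

variable {M U : Set (Euc N)} {p : Euc N → Euc N →L[ℝ] Euc N} {x : Euc N} {n : Euc N → Euc N}

theorem apply_eq_zero_iff (hp : IsProjExtension M U p) (hxM : x ∈ M) (hxU : x ∈ U) (v : Euc N) :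
    p x v = 0 ↔ v ∈ (tangentSpace M x)ᗮ := by
  rw [hp.eq_proj x hxM hxU]; exact Submodule.starProjection_apply_eq_zero_iff _

theorem eq_inner_smul (hp : IsProjExtension M U p) (hxM : x ∈ M) (hxU : x ∈ U)
    (hN : Module.finrank ℝ (tangentSpace M x) + 1 = N) (hn : IsUnitNormalField M n) {v : Euc N}
    (hv : p x v = 0) : v = (inner ℝ (n x) v : ℝ) • n x :=
  eq_inner_smul_of_mem_orthogonal hN (hn.2 x hxM).1 (hn.2 x hxM).2
    ((hp.apply_eq_zero_iff hxM hxU v).1 hv)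

theorem apply_normal (hp : IsProjExtension M U p) (hxM : x ∈ M) (hxU : x ∈ U)
    (hn : IsUnitNormalField M n) : p x (n x) = 0 :=
  (hp.apply_eq_zero_iff hxM hxU _).2 (hn.2 x hxM).1

/-- The unit normal is differentiable, and its derivative is the shape operator. -/
theorem hasFDerivWithinAt_normal (hp : IsProjExtension M U p) (hxM : x ∈ M) (hxU : x ∈ U)
    (hN : ∀ y ∈ M, Module.finrank ℝ (tangentSpace M y) + 1 = N) (hn : IsUnitNormalField M n) :
    ∃ n' : Euc N →L[ℝ] Euc N, HasFDerivWithinAt n n' M x ∧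
      ∀ a ∈ tangentSpace M x, n' a = -projD p x a (n x) := by
  have hw := (hasFDerivAt_const (n x) x).fun_sub
    ((hp.hasFDerivAt hxU).clm_apply (hasFDerivAt_const (n x) x))
  -- The normal part at y of the fixed vector n(x) is c(y) n(y) with c(y) = ⟨n(y), n(x)⟩, and its
  -- squared length is c². The normalization argument used for the Gauss map then applies.
  have hw0 : ∀ y ∈ M, y ∈ U → n x - p y (n x) = (inner ℝ (n y) (n x) : ℝ) • n y :=
    fun y hy hyU => by
      have h := hp.eq_inner_smul hy hyU (hN y hy) hn (v := n x - p y (n x))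
        (by rw [map_sub, hp.apply_apply hy hyU, sub_self])
      rwa [inner_sub_right, ← hp.inner_apply_left hy hyU, hp.apply_normal hy hyU hn,
        inner_zero_left, sub_zero] at h
  have hnn : inner ℝ (n x) (n x) = (1 : ℝ) := by
    rw [real_inner_self_eq_norm_sq, (hn.2 x hxM).2, one_pow]
  obtain ⟨n', hn', h⟩ := exists_hasFDerivWithinAt_of_eq_smul hp.isOpen hxM hxU hw
    (hw.inner ℝ hw) (c := fun y => inner ℝ (n y) (n x))
    ((hn.1 x hxM).inner continuousWithinAt_const) hnn hw0
    (fun y hy hyU => by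
      rw [hw0 y hy hyU, inner_smul_left, inner_smul_right, real_inner_self_eq_norm_sq,
        (hn.2 y hy).2, one_pow, mul_one, sq]
      rfl)
  refine ⟨n', hn', fun a ha => ?_⟩
  have hi : inner ℝ (n x) (projD p x a (n x)) = (0 : ℝ) := by
    rw [← hp.apply_projD_of_apply_eq_zero hxM hxU a (hp.apply_normal hxM hxU hn),
      ← hp.inner_apply_left hxM hxU, hp.apply_normal hxM hxU hn, inner_zero_left]
  rw [h a]
  · simp [hp.projD_of_mem hxM hxU ha]
  · simp [← hp.projD_of_mem hxM hxU ha, hp.apply_normal hxM hxU hn, hi, real_inner_comm (n x)]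


theorem dirDeriv_normal (hp : IsProjExtension M U p) (hxM : x ∈ M) (hxU : x ∈ U)
    (hN : ∀ y ∈ M, Module.finrank ℝ (tangentSpace M y) + 1 = N) (hn : IsUnitNormalField M n)
    {a : Euc N} (ha : a ∈ tangentSpace M x) : dirDeriv M n x a = -projD p x a (n x) := by
  obtain ⟨n', hn', h⟩ := hp.hasFDerivWithinAt_normal hxM hxU hN hn
  rw [dirDeriv_eq hn' ha, h a ha]

theorem projD_eq_inner_smul (hp : IsProjExtension M U p) (hxM : x ∈ M) (hxU : x ∈ U)
    (hN : Module.finrank ℝ (tangentSpace M x) + 1 = N) (hn : IsUnitNormalField M n)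
    {a b : Euc N} (hb : b ∈ tangentSpace M x) :
    projD p x a b = (inner ℝ (n x) (projD p x a b) : ℝ) • n x := by
  refine hp.eq_inner_smul hxM hxU hN hn ?_
  rw [← hp.apply_of_mem hxM hxU hb, hp.apply_projD_apply hxM hxU]

theorem projD_normal_mem (hp : IsProjExtension M U p) (hxM : x ∈ M) (hxU : x ∈ U)
    (hn : IsUnitNormalField M n) (a : Euc N) : projD p x a (n x) ∈ tangentSpace M x := by
  rw [← hp.apply_projD_of_apply_eq_zero hxM hxU a (hp.apply_normal hxM hxU hn)]
  exact hp.apply_mem hxM hxU _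

/-- The scalar mean curvature is the component of the mean curvature vector along the normal. -/
theorem meanCurvature_eq (hp : IsProjExtension M U p) (hxM : x ∈ M) (hxU : x ∈ U)
    (hN : ∀ y ∈ M, Module.finrank ℝ (tangentSpace M y) + 1 = N) (hn : IsUnitNormalField M n) :
    meanCurvature M n x = inner ℝ (meanCurvatureVector M x) (n x) := by
  rw [meanCurvature, divergence, meanCurvatureVector, frameSum, frameSum, sum_inner,
    ← Finset.sum_neg_distrib]
  refine Finset.sum_congr rfl fun j _ => ?_
  rw [hp.dirDeriv_normal hxM hxU hN hn (frame M x j).2, inner_neg_right, neg_neg,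
    ← hp.inner_projD hxM hxU,
    hp.secondFundamentalForm_eq hxM hxU (frame M x j).2 (frame M x j).2]

end IsProjExtension

section Hypersurface

variable {m : ℕ} {M : Set (Euc N)} {n : Euc N → Euc N}

/-- All values of B are multiples of n, so S_a = v ∧ n for one vector v, and (v ∧ n) ∧ (v ∧ n) = 0.
-/
theorem shapeWedgeShape_eq_zero (hM : IsSmoothSubmanifold m M)
    (hN : ∀ y ∈ M, Module.finrank ℝ (tangentSpace M y) + 1 = N) (hn : IsUnitNormalField M n)
    {x : Euc N} (hxM : x ∈ M) : shapeWedgeShape M x = 0 := by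
  obtain ⟨U, p, hxU, hp⟩ := exists_isProjExtension hM hxM
  rw [shapeWedgeShape, frameSum]
  refine Finset.sum_eq_zero fun j _ => ?_
  have hτ := (frame M x j).2
  generalize ((frame M x j : tangentSpace M x) : Euc N) = τ at hτ
  have e : frameSum M x (fun σ => vec σ * vec (projD p x τ σ)) = wedgeVecL N
      (∑ l, (inner ℝ (n x) (projD p x τ (frame M x l : Euc N)) : ℝ) • (frame M x l : Euc N))
      (n x) := by
    rw [map_sum, sum_apply]
    refine Finset.sum_congr rfl fun l _ => ?_
    rw [map_smul, smul_apply, ← map_smul, ← hp.projD_eq_inner_smul hxM hxU (hN x hxM) hn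
      (frame M x l).2]
    exact (wedge_vec_vec (hp.inner_projD_of_mem hxM hxU (frame M x l).2 (frame M x l).2)).symm
  change wedge (shape M x τ) (shapeBivector M x τ) = 0
  rw [hp.shape_eq hxM hxU hτ, hp.shapeBivector_eq hxM hxU hτ, e, wedgeVecL_apply]
  generalize (∑ l, (inner ℝ (n x) (projD p x τ (frame M x l : Euc N)) : ℝ) •
    (frame M x l : Euc N)) = v
  apply (toExt N).injective
  rw [toExt_wedge, toExt_wedge, toExt_vec, toExt_vec, map_zero]
  rw [mul_assoc, ← mul_assoc (ExteriorAlgebra.ι ℝ (n x)),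
    eq_neg_of_add_eq_zero_left (ExteriorAlgebra.ι_add_mul_swap (n x) v), neg_mul, mul_neg,
    mul_assoc, ExteriorAlgebra.ι_sq_zero, mul_zero, mul_zero, neg_zero]

/-- The derivative of the scalar mean curvature. -/
theorem gradient_meanCurvature (hM : IsSmoothSubmanifold m M)
    (hN : ∀ y ∈ M, Module.finrank ℝ (tangentSpace M y) + 1 = N) (hn : IsUnitNormalField M n)
    {x : Euc N} (hxM : x ∈ M) :
    gradient M (meanCurvature M n) x = frameSum M x fun τ =>
      (inner ℝ (n x) (dirDeriv M (meanCurvatureVector M) x τ) : ℝ) • τ := by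
  obtain ⟨U, p, hxU, hp⟩ := exists_isProjExtension hM hxM
  obtain ⟨n', hn', h⟩ := hp.hasFDerivWithinAt_normal hxM hxU hN hn
  obtain ⟨H', hH', -⟩ := hp.hasFDerivWithinAt_meanCurvatureVector hxM hxU
  refine frameSum_congr fun τ hτ => ?_
  congr 1
  rw [dirDeriv_congr hp.isOpen hxM hxU (fun y hy hyU => hp.meanCurvature_eq hy hyU hN hn),
    dirDeriv_eq (hH'.inner ℝ hn') hτ, dirDeriv_eq hH' hτ]
  -- H is normal, whereas the derivative of n is tangent.
  have h0 : inner ℝ (meanCurvatureVector M x) (n' τ) = (0 : ℝ) := by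
    rw [h τ hτ, inner_neg_right, ← hp.inner_projD hxM hxU, real_inner_comm,
      ← hp.inner_projD hxM hxU,
      ← hp.apply_of_mem hxM hxU (hp.projD_normal_mem hxM hxU hn τ),
      hp.inner_apply_left hxM hxU, hp.apply_meanCurvatureVector hxM hxU, inner_zero_right,
      neg_zero]
  simp [h0, real_inner_comm]

/-- The normal part of (τ·∂)H is a multiple of n, and n² = 1 removes n from the product. -/
theorem curl_mul_normal (hM : IsSmoothSubmanifold m M)
    (hN : ∀ y ∈ M, Module.finrank ℝ (tangentSpace M y) + 1 = N) (hn : IsUnitNormalField M n)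
    {x : Euc N} (hxM : x ∈ M) :
    curl M (fun y => vec (meanCurvatureVector M y)) x * vec (n x)
      = vec (gradient M (meanCurvature M n) x) := by
  obtain ⟨U, p, hxU, hp⟩ := exists_isProjExtension hM hxM
  rw [gradient_meanCurvature hM hN hn hxM, hp.curl_eq_normal hxM hxU, frameSum, frameSum,
    Finset.sum_mul]
  refine Eq.trans (Finset.sum_congr rfl fun j _ => ?_)
    (map_sum (CliffordAlgebra.ι (sqForm N)) _ _).symm
  change vec (frame M x j : Euc N) * CliffordAlgebra.ι (sqForm N) _ * vec (n x)
    = CliffordAlgebra.ι (sqForm N) _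
  generalize dirDeriv M (meanCurvatureVector M) x (frame M x j : Euc N) = v
  rw [hp.eq_inner_smul hxM hxU (hN x hxM) hn (v := v - p x v)
    (by rw [map_sub, hp.apply_apply hxM hxU, sub_self]), inner_sub_right,
    ← hp.inner_apply_left hxM hxU, hp.apply_normal hxM hxU hn, inner_zero_left, sub_zero,
    map_smul, map_smul, mul_smul_comm, smul_mul_assoc, mul_assoc, vec_mul_self,
    real_inner_self_eq_norm_sq,
    (hn.2 x hxM).2, one_pow, map_one, mul_one]

/-- Jacobi's field equation for the unit normal of a hypersurface. -/
theorem jacobi_normal (hM : IsSmoothSubmanifold m M)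
    (hN : ∀ y ∈ M, Module.finrank ℝ (tangentSpace M y) + 1 = N) (hn : IsUnitNormalField M n)
    {x : Euc N} (hxM : x ∈ M) :
    laplaceBeltrami M n x + normSqB M x • n x + gradient M (meanCurvature M n) x = 0 := by
  obtain ⟨U, p, hxU, hp⟩ := exists_isProjExtension hM hxM
  obtain ⟨n', hn', h⟩ := hp.hasFDerivWithinAt_normal hxM hxU hN hn
  have hpn := hp.apply_normal hxM hxU hn
  have hΔ : laplaceBeltrami M n x = -IsProjExtension.trace M p x (n x)
      + frameSum M x fun τ => projD p x τ (projD p x τ (n x)) := by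
    rw [IsProjExtension.trace_apply, laplaceBeltrami, frameSum, frameSum, frameSum,
      ← Finset.sum_neg_distrib,
      ← Finset.sum_add_distrib]
    refine Finset.sum_congr rfl fun j _ => ?_
    have hτ := (frame M x j).2
    generalize ((frame M x j : tangentSpace M x) : Euc N) = τ at hτ
    have h1 := (hp.hasFDerivAt_projD hxU).clm_apply (hasFDerivAt_const τ x)
    change dirDeriv M (fun y => dirDeriv M n y (proj M y τ)) x τ = _
    rw [dirDeriv_congr hp.isOpen hxM hxU (G := fun y => -projD p y τ (n y)) (fun y hy hyU => by
        rw [hp.dirDeriv_normal hy hyU hN hn (proj_mem M y τ), ← hp.eq_proj y hy hyU,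
          hp.projD_apply_left hy hyU]),
      dirDeriv_eq (h1.hasFDerivWithinAt.clm_apply hn').fun_neg hτ]
    simp [h τ hτ, add_comm]
  set R := frameSum M x fun τ => projD p x τ (projD p x τ (n x)) with hR
  -- the normal component
  have hR1 : R = normSqB M x • n x := by
    have e1 : p x R = 0 := by
      rw [hR, frameSum, map_sum]
      refine Finset.sum_eq_zero fun j _ => ?_
      rw [← hp.apply_of_mem hxM hxU (hp.projD_normal_mem hxM hxU hn _),
        hp.apply_projD_apply hxM hxU]
    rw [hp.eq_inner_smul hxM hxU (hN x hxM) hn e1, hp.normSqB_eq hxM hxU]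
    congr 1
    rw [hR, frameSum, frameSum, inner_sum]
    refine Finset.sum_congr rfl fun j _ => ?_
    generalize ((frame M x j : tangentSpace M x) : Euc N) = τ
    rw [← hp.inner_projD hxM hxU]
    have hv := hp.projD_normal_mem hxM hxU hn τ
    have e2 := (frame M x).sum_sq_norm_inner_right (⟨_, hv⟩ : tangentSpace M x)
    rw [real_inner_self_eq_norm_sq]
    refine Eq.trans e2.symm (Finset.sum_congr rfl fun l _ => ?_)
    rw [hp.projD_eq_inner_smul hxM hxU (hN x hxM) hn (frame M x l).2, norm_smul,
      (hn.2 x hxM).2, mul_one, ← hp.inner_projD hxM hxU, real_inner_comm]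
    rfl
  -- Differentiating P² = P twice and applying it to n gives each mixed term D_τ D_τ n twice. One
  -- copy cancels the sum in Δn and the other gives -|B|² n.
  have hK : IsProjExtension.trace M p x (n x)
      = p x (IsProjExtension.trace M p x (n x)) + R + R := by
    rw [IsProjExtension.trace_apply, hR, frameSum, frameSum, map_sum, ← Finset.sum_add_distrib,
      ← Finset.sum_add_distrib]
    refine Finset.sum_congr rfl fun j _ => ?_
    have e := hp.fderiv_projD_add hxM hxU (frame M x j).2 (frame M x j : Euc N) (n x)
    rw [hpn, map_zero, zero_add] at e
    conv_lhs => rw [← e]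
    abel
  -- the tangential component
  have hg : gradient M (meanCurvature M n) x = p x (IsProjExtension.trace M p x (n x)) := by
    rw [gradient_meanCurvature hM hN hn hxM, hp.eq_proj x hxM hxU, proj_eq_sum (frame M x)]
    refine Finset.sum_congr rfl fun j _ => ?_
    refine congrArg (fun c : ℝ => c • (frame M x j : Euc N)) ?_
    -- K(τ) - (τ·∂)H is tangent, so ⟨n, (τ·∂)H⟩ = ⟨n, K(τ)⟩ = ⟨K(n), τ⟩.
    have hd := (hn.2 x hxM).1 _
      (hp.dirDeriv_meanCurvatureVector_sub_mem hxM hxU (frame M x j).2)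
    rw [inner_sub_left, sub_eq_zero, hp.inner_trace hxM hxU] at hd
    rw [hd, real_inner_comm]
  rw [hg, hΔ, hK, ← hR1]
  simp only [map_add, hp.apply_apply hxM hxU]
  have e1 : p x R = 0 := by rw [hR1, map_smul, hpn, smul_zero]
  rw [e1]
  abel

end Hypersurface

end GeomCalc

end

theorem mainTheorem4 (N m : ℕ) (M : Set (GeomCalc.Euc N))
    (hM : GeomCalc.IsSmoothSubmanifold m M)
    (T : GeomCalc.Euc N → GeomCalc.GA N) (hT : GeomCalc.IsGaussMap m M T) :
    (∀ x ∈ M,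
      GeomCalc.laplaceBeltrami M T x + GeomCalc.normSqB M x • T x
        - GeomCalc.gradePart m (GeomCalc.shapeWedgeShape M x * T x)
        + GeomCalc.curl M (fun y => GeomCalc.vec (GeomCalc.meanCurvatureVector M y)) x * T x = 0) ∧
    (N = m + 1 → ∀ n : GeomCalc.Euc N → GeomCalc.Euc N, GeomCalc.IsUnitNormalField M n →
      ∀ x ∈ M,
        GeomCalc.shapeWedgeShape M x = 0 ∧
        GeomCalc.curl M (fun y => GeomCalc.vec (GeomCalc.meanCurvatureVector M y)) x
            * GeomCalc.vec (n x) =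
          GeomCalc.vec (GeomCalc.gradient M (GeomCalc.meanCurvature M n) x) ∧
        GeomCalc.laplaceBeltrami M n x + GeomCalc.normSqB M x • n x
          + GeomCalc.gradient M (GeomCalc.meanCurvature M n) x = 0) := by
  refine ⟨fun x hx => ?_, fun hNm n hn x hx => ?_⟩
  · obtain ⟨U, p, hxU, hp⟩ := GeomCalc.exists_isProjExtension hM hx
    obtain ⟨T', hT', -⟩ := hp.hasFDerivWithinAt_gaussMap hx hxU hT
    refine hp.jacobi_gaussMap hx hxU hT hT' fun y hy a ha => ?_
    -- The first-order equation is required at all points of M, so each y receives its own local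
    -- extension.
    obtain ⟨V, q, hyV, hq⟩ := GeomCalc.exists_isProjExtension hM hy
    obtain ⟨T'', hT'', h⟩ := hq.hasFDerivWithinAt_gaussMap hy hyV hT
    rw [GeomCalc.dirDeriv_eq hT'' ha, h a ha]
  · have hN : ∀ y ∈ M, Module.finrank ℝ (GeomCalc.tangentSpace M y) + 1 = N := fun y hy => by
      rw [hT.finrank_tangentSpace hy, hNm]
    exact ⟨GeomCalc.shapeWedgeShape_eq_zero hM hN hn hx,
      GeomCalc.curl_mul_normal hM hN hn hx, GeomCalc.jacobi_normal hM hN hn hx⟩
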